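/- All graphs are finite and simple. For a connected graph $G$ on $n\ge 2$ vertices, with $d_u$ the degree of $u$, the normalized Laplacian matrix $\mathcal L(G)=[l_{uv}]$ is given by $l_{uu}=1$, $l_{uv}=-1/\sqrt{d_ud_v}$ if $u\sim v$, and $l_{uv}=0$ otherwise; its eigenvalues, listed with multiplicity, are $\rho_1(G)\ge\rho_2(G)\ge\cdots\ge\rho_{n-1}(G)\ge\rho_n(G)=0$. For $n\ge 5$, let $\mathcal G_1(n,n-3)$ be the set of all connected graphs $G$ on $n$ vertices such that some eigenvalue of $\mathcal L(G)$ has multiplicity exactly $n-3$, $\rho_{n-1}(G)\ne 1$, and the independence number of $G$ is $2$. A cograph is a graph without an induced path $P_4$ on four vertices. For integers $a,b\ge 0$ with $a+b+4=n$, let $G_1=G_1(a,b)$ be the graph on $n$ vertices obtained from two disjoint cliques $K_{a+1}$ and $K_{b+1}$ by joining every vertex of $K_{a+1}$ to every vertex of $K_{b+1}$, adding a new vertex $v_1$ whose neighbours are exactly the vertices of $K_{a+1}$, and adding a new vertex $v_n$ whose neighbours are exactly the vertices of $K_{b+1}$. Let $G_2$ be the graph on $n$ vertices obtained from the complete graph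 $K_{n-1}$ by attaching one pendant vertex to one of its vertices. **Theorem 1.1.** Let $G$ be a graph of order $n\ge 5$. Then (i) $G\in\mathcal G_1(n,n-3)$ and $G$ has diameter $3$ if and only if $G$ is isomorphic to $G_1(a,b)$ for some integers $a,b\ge 0$ with $a+b+4=n$; (ii) $G\in\mathcal G_1(n,n-3)$ and $G$ is a cograph if and only if $G$ is isomorphic to $G_2$. -/

import Mathlib

open SimpleGraph

/-- The normalized Laplacian matrix `I - D^{-1/2} A D^{-1/2}`, entry by entry:
`1` on the diagonal, `-1/√(d_u d_v)` if `u ~ v`, and `0` otherwise. -/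
noncomputable def normLapMatrix {V : Type*} [Fintype V] [DecidableEq V]
    (G : SimpleGraph V) [DecidableRel G.Adj] : Matrix V V ℝ :=
  Matrix.of fun u v =>
    if u = v then 1
    else if G.Adj u v then -1 / Real.sqrt ((G.degree u : ℝ) * (G.degree v : ℝ))
    else 0

theorem normLapMatrix_isHermitian {V : Type*} [Fintype V] [DecidableEq V]
    (G : SimpleGraph V) [DecidableRel G.Adj] : (normLapMatrix G).IsHermitian := by
  ext u v
  simp only [Matrix.conjTranspose_apply, star_trivial, normLapMatrix, Matrix.of_apply,
    G.adj_comm v u, mul_comm (G.degree v : ℝ), eq_comm (a := v)]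

/-- The normalized Laplacian eigenvalues, repeated with multiplicity and listed in decreasing
order: `rho G i` is the eigenvalue `ρ_{i+1}(G)` of the list `ρ_1(G) ≥ ρ_2(G) ≥ ⋯ ≥ ρ_n(G)`. -/
noncomputable def rho {V : Type*} [Fintype V] [DecidableEq V]
    (G : SimpleGraph V) [DecidableRel G.Adj] : Fin (Fintype.card V) → ℝ :=
  (normLapMatrix_isHermitian G).eigenvalues₀

/-- The multiplicity of `θ` as a normalized Laplacian eigenvalue (`0` if it is none): the
dimension of its eigenspace. -/
noncomputable def normLapMultiplicity {V : Type*} [Fintype V] [DecidableEq V]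
    (G : SimpleGraph V) [DecidableRel G.Adj] (θ : ℝ) : ℕ :=
  Module.finrank ℝ (Module.End.eigenspace (Matrix.toLin' (normLapMatrix G)) θ)

/-- The class `𝒢(n, n-3)`: connected graphs on `n ≥ 5` vertices with some normalized Laplacian
eigenvalue of multiplicity `n - 3`. -/
structure InClassG {V : Type*} [Fintype V] [DecidableEq V]
    (G : SimpleGraph V) [DecidableRel G.Adj] : Prop where
  five_le_card : 5 ≤ Fintype.card V
  connected : G.Connected
  exists_eigenvalue : ∃ θ : ℝ, normLapMultiplicity G θ = Fintype.card V - 3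

/-- The class `𝒢₁(n, n-3)`: the graphs in `𝒢(n, n-3)` with `ρ_{n-1}(G) ≠ 1` and independence
number `2`. The eigenvalue `ρ_{n-1}(G)` has index `n - 2` when counting from `0`. -/
structure InClassG1 {V : Type*} [Fintype V] [DecidableEq V]
    (G : SimpleGraph V) [DecidableRel G.Adj] : Prop extends InClassG G where
  rho_ne_one : rho G ⟨Fintype.card V - 2, by omega⟩ ≠ 1
  indepNum_eq : G.indepNum = 2

/-- A cograph: a graph without an induced path on four vertices. -/
def IsCograph {V : Type*} (G : SimpleGraph V) : Prop :=
  ¬ (pathGraph 4).IsIndContained G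

/-- The position of a vertex of `graphG1 a b` in the chain
`{v_1}, K_{a+1}, K_{b+1}, {v_n}`. -/
def graphG1Level (a b : ℕ) : Unit ⊕ Fin (a + 1) ⊕ Fin (b + 1) ⊕ Unit → ℕ
  | .inl _ => 0
  | .inr (.inl _) => 1
  | .inr (.inr (.inl _)) => 2
  | .inr (.inr (.inr _)) => 3

/-- The graph `G_1`: two disjoint cliques `K_{a+1}` and `K_{b+1}` joined completely, a vertex
`v_1` adjacent to exactly the vertices of `K_{a+1}`, and a vertex `v_n` adjacent to exactly the
vertices of `K_{b+1}`. That is, distinct vertices are adjacent exactly when their positions in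
the chain `{v_1}, K_{a+1}, K_{b+1}, {v_n}` differ by at most one. -/
def graphG1 (a b : ℕ) : SimpleGraph (Unit ⊕ Fin (a + 1) ⊕ Fin (b + 1) ⊕ Unit) where
  Adj u v := u ≠ v ∧ graphG1Level a b u ≤ graphG1Level a b v + 1 ∧
    graphG1Level a b v ≤ graphG1Level a b u + 1
  symm := ⟨fun _ _ h => ⟨h.1.symm, h.2.2, h.2.1⟩⟩
  loopless := ⟨fun _ h => h.1 rfl⟩

/-- The graph `G_2` on `n` vertices: a clique `K_{n-1}` on `{1, …, n-1}` and a vertex `0`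
adjacent only to the vertex `1` of it. -/
def graphG2 (n : ℕ) : SimpleGraph (Fin n) where
  Adj u v := u ≠ v ∧ ((u.val ≠ 0 ∧ v.val ≠ 0) ∨ (u.val = 0 ∧ v.val = 1) ∨
    (u.val = 1 ∧ v.val = 0))
  symm := ⟨fun _ _ h => ⟨h.1.symm, by tauto⟩⟩
  loopless := ⟨fun _ h => h.1 rfl⟩

/-!
The matrix `ℒ - θ` is, up to sign, congruent through `D^{-1/2}` to `A + c D` with `c = θ - 1`, so
the multiplicity of `θ` is `n - rank (A + c D)` (`normLapMultiplicity_add_rank`), and a multiplicity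
`n - 3` means that some `A + c D` has rank `3`. In that case all `4 × 4` minors of this matrix,
whose off-diagonal entries are `0` or `1`, vanish (`minor_four_eq_zero`).

Diameter `3`. Let `u`, `v` be at distance `3`. As the independence number is `2`, the closed
neighbourhoods of `u` and `v` are cliques partitioning the vertex set
(`exists_isClosedNeighborPartition`). If `p ∈ N(u)` and `q ∈ N(v)` are adjacent, the block with rows
`u, p, q` and columns `p, q, v` is unitriangular, so the minors bordering it determine `c d_x` for
every `x ∈ N(u)`. Comparing degrees forces every `x ∈ N(u)` to be adjacent to `q`
(`IsClosedNeighborPartition.adj_of_adj`), hence, by symmetry, all edges between `N(u)` and `N(v)` to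
be present: this is the chain `G₁(a, b)`.

Cographs. A complete multipartite graph that is not complete has `ρ_{n-1} = 1`, because its
adjacency form is nonpositive on a hyperplane (`rho_eq_one_of_isCompleteMultipartite`). If `G` is not complete
multipartite, the absence of induced paths `P₄` shows that `G` is the join of a graph on `R` with a
disjoint union of two cliques `P`, `Q`, where `|Q| ≥ 2` (`exists_isTwoCliqueJoin`). Rank at most `3`
forces `c d_x = 1` on `Q`, and on `P` if `|P| ≥ 2` (`IsTwoCliqueJoin.weight_eq_one`), and then
`|R| = 1` (`IsTwoCliqueJoin.card_R_eq_one`). With `|P| ≥ 2` the rank would drop to `2`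
(`IsTwoCliqueJoin.card_P_eq_one`), so `P` is a pendant vertex and `G` is `G₂`.

Conversely, `G₁(a, b)` and `G₂` are described by a level function along a chain of cliques. With
`c = 1 / (n - 2)` the entries of `A + c D` depend on the levels only, which gives rank `3`, and the
adjacency matrix is nonsingular, so that `1` is not an eigenvalue of `ℒ`.
-/

/-! ### The spectrum of the normalized Laplacian -/

section Spectrum

variable {V : Type*} [Fintype V] [DecidableEq V] (G : SimpleGraph V) [DecidableRel G.Adj]

/-- The matrix `A + c D`, with `A` the adjacency matrix and `D` the diagonal matrix of the degrees.
Up to the congruence by `D^{-1/2}` and a sign, it is `ℒ - (c + 1)`. -/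
noncomputable def adjAddDegMatrix (c : ℝ) : Matrix V V ℝ :=
  Matrix.of fun u v => if u = v then c * G.degree u else if G.Adj u v then 1 else 0

variable {G}

lemma adjAddDegMatrix_self (c : ℝ) (u : V) : adjAddDegMatrix G c u u = c * G.degree u := by
  simp [adjAddDegMatrix]

lemma adjAddDegMatrix_adj (c : ℝ) {u v : V} (h : G.Adj u v) : adjAddDegMatrix G c u v = 1 := by
  simp [adjAddDegMatrix, h.ne, h]

lemma adjAddDegMatrix_not_adj (c : ℝ) {u v : V} (hne : u ≠ v) (h : ¬ G.Adj u v) :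
    adjAddDegMatrix G c u v = 0 := by
  simp [adjAddDegMatrix, hne, h]

lemma adjAddDegMatrix_symm (c : ℝ) (u v : V) :
    adjAddDegMatrix G c u v = adjAddDegMatrix G c v u := by
  by_cases h : u = v
  · rw [h]
  · simp [adjAddDegMatrix, h, Ne.symm h, G.adj_comm u v]

variable (G) in
lemma normLapMatrix_eq :
    normLapMatrix G = 1 - Matrix.diagonal (fun v => (√(G.degree v : ℝ))⁻¹) * G.adjMatrix ℝ *
      Matrix.diagonal (fun v => (√(G.degree v : ℝ))⁻¹) := by
  ext u v
  rw [Matrix.sub_apply, Matrix.mul_diagonal, Matrix.diagonal_mul, Matrix.one_apply,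
    adjMatrix_apply]
  simp only [normLapMatrix, Matrix.of_apply]
  by_cases h : u = v
  · subst h; simp
  · by_cases ha : G.Adj u v
    · simp only [h, ha, if_true, if_false]
      rw [Real.sqrt_mul (Nat.cast_nonneg _), zero_sub, neg_div, one_div, mul_inv, mul_one]
    · simp [h, ha]

lemma normLapMatrix_sub_smul_one (hpos : ∀ v, 0 < G.degree v) (θ : ℝ) :
    normLapMatrix G - θ • 1 = Matrix.diagonal (fun v => -(√(G.degree v : ℝ))⁻¹) *
      (adjAddDegMatrix G (θ - 1) * Matrix.diagonal (fun v => (√(G.degree v : ℝ))⁻¹)) := by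
  rw [normLapMatrix_eq]
  ext u v
  rw [Matrix.diagonal_mul, Matrix.mul_diagonal, Matrix.sub_apply, Matrix.sub_apply,
    Matrix.mul_diagonal, Matrix.diagonal_mul, Matrix.smul_apply, adjMatrix_apply]
  by_cases h : u = v
  · subst h
    rw [adjAddDegMatrix_self]
    have h1 : (0 : ℝ) < G.degree u := by exact_mod_cast hpos u
    have h2 : √(G.degree u : ℝ) ≠ 0 := (Real.sqrt_pos.2 h1).ne'
    have h3 : √(G.degree u : ℝ) ^ 2 = G.degree u := Real.sq_sqrt h1.le
    simp only [Matrix.one_apply_eq, SimpleGraph.irrefl, if_false, smul_eq_mul]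
    have h4 : ∀ t d : ℝ, t ≠ 0 → t ^ 2 = d → t⁻¹ * d * t⁻¹ = 1 := by
      rintro t _ ht rfl
      field_simp
    linear_combination (θ - 1) * h4 _ _ h2 h3
  · by_cases ha : G.Adj u v <;> simp [adjAddDegMatrix, h, ha]

lemma normLapMultiplicity_add_rank (hpos : ∀ v, 0 < G.degree v) (θ : ℝ) :
    normLapMultiplicity G θ + (adjAddDegMatrix G (θ - 1)).rank = Fintype.card V := by
  have hdet : ∀ ε : ℝ, ε ≠ 0 →
      (Matrix.diagonal (fun v => ε * (√(G.degree v : ℝ))⁻¹)).det ≠ 0 := by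
    intro ε hε
    rw [Matrix.det_diagonal, Finset.prod_ne_zero_iff]
    intro v _
    have h1 : (0 : ℝ) < G.degree v := by exact_mod_cast hpos v
    exact mul_ne_zero hε (inv_ne_zero (Real.sqrt_pos.2 h1).ne')
  have hr : (adjAddDegMatrix G (θ - 1)).rank = (normLapMatrix G - θ • 1).rank := by
    rw [normLapMatrix_sub_smul_one hpos, Matrix.rank_mul_eq_right_of_det_ne_zero _ _
        (by simpa using hdet (-1) (by norm_num)),
      Matrix.rank_mul_eq_left_of_det_ne_zero _ _ (by simpa using hdet 1 one_ne_zero)]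
  have hlin : Matrix.toLin' (normLapMatrix G) - θ • (1 : Module.End ℝ (V → ℝ)) =
      (normLapMatrix G - θ • 1).mulVecLin := by
    ext x
    simp
  rw [hr, normLapMultiplicity, Module.End.eigenspace_def, hlin, Matrix.rank, add_comm,
    LinearMap.finrank_range_add_finrank_ker, Module.finrank_pi]

variable (G) in
lemma normLapMatrix_mulVec_apply (y : V → ℝ) (u : V) :
    (normLapMatrix G).mulVec y u = y u - (√(G.degree u : ℝ))⁻¹ *
      ∑ v ∈ G.neighborFinset u, (√(G.degree v : ℝ))⁻¹ * y v := by
  rw [normLapMatrix_eq, Matrix.sub_mulVec, Matrix.one_mulVec, ← Matrix.mulVec_mulVec,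
    ← Matrix.mulVec_mulVec, Pi.sub_apply, Matrix.mulVec_diagonal, adjMatrix_mulVec_apply]
  simp only [Matrix.mulVec_diagonal]

lemma exists_rho_eq_iff {θ : ℝ} :
    (∃ i, rho G i = θ) ↔ ∃ y ≠ 0, (normLapMatrix G).mulVec y = θ • y := by
  have hrange : (∃ i, rho G i = θ) ↔
      θ ∈ Set.range (normLapMatrix_isHermitian G).eigenvalues := by
    constructor
    · rintro ⟨i, rfl⟩
      exact ⟨Fintype.equivOfCardEq (Fintype.card_fin _) i, by
        simp [Matrix.IsHermitian.eigenvalues, rho]⟩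
    · rintro ⟨j, rfl⟩
      exact ⟨_, rfl⟩
  rw [hrange, ← Matrix.IsHermitian.spectrum_real_eq_range_eigenvalues,
    ← Matrix.spectrum_toLin', ← Module.End.hasEigenvalue_iff_mem_spectrum]
  constructor
  · intro h
    obtain ⟨y, hy⟩ := h.exists_hasEigenvector
    exact ⟨y, hy.2, by simpa using hy.apply_eq_smul⟩
  · rintro ⟨y, hy, h⟩
    exact Module.End.hasEigenvalue_of_hasEigenvector
      ⟨Module.End.mem_eigenspace_iff.2 (by simpa using h), hy⟩

/-- If `1` is a normalized Laplacian eigenvalue, then the adjacency matrix is singular. -/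
lemma exists_adj_kernel_of_rho_eq_one (hpos : ∀ v, 0 < G.degree v)
    {i : Fin (Fintype.card V)} (h : rho G i = 1) :
    ∃ x : V → ℝ, x ≠ 0 ∧ ∀ u, ∑ v ∈ G.neighborFinset u, x v = 0 := by
  obtain ⟨y, hy, hy1⟩ := exists_rho_eq_iff.1 ⟨i, h⟩
  have hs : ∀ v, (√(G.degree v : ℝ))⁻¹ ≠ 0 := fun v =>
    inv_ne_zero (Real.sqrt_pos.2 (by exact_mod_cast hpos v)).ne'
  refine ⟨fun v => (√(G.degree v : ℝ))⁻¹ * y v, ?_, fun u => ?_⟩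
  · contrapose! hy
    ext v
    simpa [hs v] using congrFun hy v
  · have := congrFun hy1 u
    rw [normLapMatrix_mulVec_apply, one_smul, sub_eq_self] at this
    exact (mul_eq_zero.1 this).resolve_left (hs u)

omit [DecidableEq V] in
/-- In a complete multipartite graph the adjacency form is `(∑ x)²` minus the sum of the squares of
the sums of `x` over the parts, hence nonpositive on the vectors with `∑ x = 0`. -/
lemma sum_adj_le_zero (hmp : G.IsCompleteMultipartite) {x : V → ℝ} (hx : ∑ v, x v = 0) :
    ∑ u, x u * ∑ v ∈ G.neighborFinset u, x v ≤ 0 := by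
  classical
  let st := hmp.setoid
  have h1 : ∀ u, ∑ v ∈ G.neighborFinset u, x v =
      -∑ v with (Quotient.mk st v = Quotient.mk st u), x v := by
    intro u
    rw [← zero_add (-_), ← hx, ← sub_eq_add_neg, eq_sub_iff_add_eq,
      ← Finset.sum_filter_add_sum_filter_not Finset.univ (fun v => G.Adj u v)]
    congr 1
    · exact Finset.sum_congr (by ext v; simp) fun _ _ => rfl
    · refine Finset.sum_congr ?_ fun _ _ => rfl
      ext v
      simp only [Finset.mem_filter, Finset.mem_univ, true_and]
      rw [Quotient.eq]
      change ¬ G.Adj v u ↔ _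
      rw [G.adj_comm]
  have h2 : ∑ u, x u * ∑ v ∈ G.neighborFinset u, x v =
      -∑ q : Quotient st, (∑ v with (Quotient.mk st v = q), x v) ^ 2 := by
    rw [← Finset.sum_fiberwise Finset.univ (fun u => Quotient.mk st u), ← Finset.sum_neg_distrib]
    refine Finset.sum_congr rfl fun q _ => ?_
    rw [sq, Finset.sum_mul, ← Finset.sum_neg_distrib]
    refine Finset.sum_congr rfl fun u hu => ?_
    rw [h1, (Finset.mem_filter.1 hu).2, mul_neg]
  rw [h2]
  exact neg_nonpos.2 (Finset.sum_nonneg fun _ _ => sq_nonneg _)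

/-- A complete multipartite graph that is not complete has `ρ_{n-1} = 1`: two nonadjacent vertices
give the eigenvalue `1`, and since the adjacency form is nonpositive on a hyperplane, at most one
eigenvalue of `ℒ` is below `1`. -/
lemma rho_eq_one_of_isCompleteMultipartite (hpos : ∀ v, 0 < G.degree v)
    (hmp : G.IsCompleteMultipartite) {a b : V} (hab : a ≠ b) (hnab : ¬ G.Adj a b)
    (h2 : Fintype.card V - 2 < Fintype.card V) :
    rho G ⟨Fintype.card V - 2, h2⟩ = 1 := by
  have hcard : 1 < Fintype.card V := Fintype.one_lt_card_iff.2 ⟨a, b, hab⟩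
  have hs0 : ∀ v, 0 < √(G.degree v : ℝ) := fun v =>
    Real.sqrt_pos.2 (by exact_mod_cast hpos v)
  have hanti : Antitone (rho G) := Matrix.IsHermitian.eigenvalues₀_antitone _
  set k : Fin (Fintype.card V) := ⟨Fintype.card V - 2, h2⟩ with hk
  set l : Fin (Fintype.card V) := ⟨Fintype.card V - 1, by omega⟩ with hl
  obtain ⟨i1, hi1⟩ : ∃ i, rho G i = 1 := by
    refine exists_rho_eq_iff.2 ⟨Pi.single a 1 - Pi.single b 1, ?_, ?_⟩
    · intro h
      have := congrFun h a
      simp [hab] at this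
    · have hN : ∀ u, G.Adj u a ↔ G.Adj u b := fun u =>
        not_iff_not.1 ⟨fun h => hmp.trans _ _ _ h hnab,
          fun h => hmp.trans _ _ _ h fun h' => hnab h'.symm⟩
      have hd : G.degree a = G.degree b := by
        rw [← card_neighborFinset_eq_degree, ← card_neighborFinset_eq_degree]
        congr 1
        ext u
        simp [G.adj_comm _ u, hN u]
      ext u
      rw [normLapMatrix_mulVec_apply, one_smul, sub_eq_self]
      refine mul_eq_zero_of_right _ ?_
      simp only [Pi.sub_apply, mul_sub, Finset.sum_sub_distrib, Pi.single_apply, mul_ite, mul_one,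
        mul_zero, Finset.sum_ite_eq', mem_neighborFinset, hN u, hd, sub_self]
  obtain ⟨i0, hi0⟩ : ∃ i, rho G i = 0 := by
    refine exists_rho_eq_iff.2 ⟨fun v => √(G.degree v : ℝ), ?_, ?_⟩
    · intro h
      exact (hs0 a).ne' (congrFun h a)
    · ext u
      rw [normLapMatrix_mulVec_apply]
      rw [Finset.sum_congr rfl fun v _ => inv_mul_cancel₀ (hs0 v).ne']
      simp only [Finset.sum_const, card_neighborFinset_eq_degree, nsmul_eq_mul, mul_one, zero_smul,
        Pi.zero_apply]
      have := hs0 u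
      have h3 := Real.sq_sqrt (Nat.cast_nonneg (α := ℝ) (G.degree u))
      field_simp
      linarith
  rcases lt_trichotomy (rho G k) 1 with hlt | heq | hgt
  · exfalso
    have hlt' : rho G l < 1 := (hanti (show k ≤ l by simp [hk, hl, Fin.le_def]; omega)).trans_lt hlt
    set H := normLapMatrix_isHermitian G
    set e := Fintype.equivOfCardEq (Fintype.card_fin (Fintype.card V)) with he
    have hek : H.eigenvalues (e k) = rho G k := by simp [Matrix.IsHermitian.eigenvalues, rho, e]
    have hel : H.eigenvalues (e l) = rho G l := by simp [Matrix.IsHermitian.eigenvalues, rho, e]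
    have hkl : e k ≠ e l := by
      rw [e.injective.ne_iff, hk, hl, Ne, Fin.mk.injEq]
      omega
    set f : V → ℝ := ⇑(H.eigenvectorBasis (e k)) with hf
    set g : V → ℝ := ⇑(H.eigenvectorBasis (e l)) with hg
    have horth := H.eigenvectorBasis.orthonormal
    have hff : ∑ v, f v * f v = 1 := by
      have h1 := horth.1 (e k)
      have h2 := real_inner_self_eq_norm_sq (H.eigenvectorBasis (e k))
      rw [h1, PiLp.inner_apply] at h2
      simpa [hf, ← sq] using h2
    have hgg : ∑ v, g v * g v = 1 := by
      have h1 := horth.1 (e l)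
      have h2 := real_inner_self_eq_norm_sq (H.eigenvectorBasis (e l))
      rw [h1, PiLp.inner_apply] at h2
      simpa [hg, ← sq] using h2
    have hfg : ∑ v, f v * g v = 0 := by
      have h2 : inner ℝ (H.eigenvectorBasis (e k)) (H.eigenvectorBasis (e l)) = 0 := horth.2 hkl
      rw [PiLp.inner_apply] at h2
      simpa [hf, hg, mul_comm] using h2
    have hLf : (normLapMatrix G).mulVec f = rho G k • f := by
      rw [← hek]; exact H.mulVec_eigenvectorBasis (e k)
    have hLg : (normLapMatrix G).mulVec g = rho G l • g := by
      rw [← hel]; exact H.mulVec_eigenvectorBasis (e l)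
    -- a nonzero combination of the two eigenvectors in the hyperplane `∑ y_v / √d_v = 0`
    obtain ⟨α, β, hαβ, hsum⟩ : ∃ α β : ℝ, 0 < α ^ 2 + β ^ 2 ∧
        ∑ v, (√(G.degree v : ℝ))⁻¹ * (α * f v + β * g v) = 0 := by
      have hlin : ∀ α β : ℝ, ∑ v, (√(G.degree v : ℝ))⁻¹ * (α * f v + β * g v) =
          α * (∑ v, (√(G.degree v : ℝ))⁻¹ * f v) + β * ∑ v, (√(G.degree v : ℝ))⁻¹ * g v := by
        intro α β
        rw [Finset.mul_sum, Finset.mul_sum, ← Finset.sum_add_distrib]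
        exact Finset.sum_congr rfl fun _ _ => by ring
      by_cases hz : ∑ v, (√(G.degree v : ℝ))⁻¹ * f v = 0
      · exact ⟨1, 0, by norm_num, by rw [hlin, hz]; ring⟩
      · refine ⟨-∑ v, (√(G.degree v : ℝ))⁻¹ * g v, ∑ v, (√(G.degree v : ℝ))⁻¹ * f v, ?_, ?_⟩
        · positivity
        · rw [hlin]; ring
    have hle := sum_adj_le_zero hmp hsum
    have hval : ∀ u, (√(G.degree u : ℝ))⁻¹ * (α * f u + β * g u) *
        ∑ v ∈ G.neighborFinset u, (√(G.degree v : ℝ))⁻¹ * (α * f v + β * g v) =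
        α ^ 2 * (1 - rho G k) * (f u * f u) + β ^ 2 * (1 - rho G l) * (g u * g u) +
          α * β * (2 - rho G k - rho G l) * (f u * g u) := by
      intro u
      have h1 := normLapMatrix_mulVec_apply G (fun v => α * f v + β * g v) u
      have h3 : (fun v => α * f v + β * g v) = α • f + β • g := rfl
      rw [h3, Matrix.mulVec_add, Matrix.mulVec_smul, Matrix.mulVec_smul, hLf, hLg] at h1
      simp only [Pi.add_apply, Pi.smul_apply, smul_eq_mul] at h1
      linear_combination (α * f u + β * g u) * h1
    rw [Finset.sum_congr rfl fun u _ => hval u, Finset.sum_add_distrib, Finset.sum_add_distrib,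
      ← Finset.mul_sum, ← Finset.mul_sum, ← Finset.mul_sum, hff, hgg, hfg] at hle
    have hm1 : 0 < 1 - rho G k := by linarith
    have hm2 : 0 < 1 - rho G l := by linarith
    by_cases hα : α = 0
    · have : 0 < β ^ 2 := by simpa [hα] using hαβ
      nlinarith [mul_pos this hm2, mul_nonneg (sq_nonneg α) hm1.le]
    · have : 0 < α ^ 2 := by positivity
      nlinarith [mul_pos this hm1, mul_nonneg (sq_nonneg β) hm2.le]
  · exact heq
  · -- all eigenvalues but the last exceed `1`, so the last one cannot be both `0` and `1`
    exfalso
    have hlast : ∀ i, rho G i ≤ 1 → i = l := by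
      intro i hi
      by_contra hne
      have : i ≤ k := by
        have := i.isLt
        rw [hl, Fin.ext_iff] at hne
        simp only [hk, Fin.le_def] at hne ⊢
        omega
      linarith [hanti this]
    have e1 := hlast i1 hi1.le
    have e0 := hlast i0 (by rw [hi0]; norm_num)
    rw [e1] at hi1
    rw [e0, hi1] at hi0
    norm_num at hi0

end Spectrum

/-! ### Rank and minors -/

section Minors

variable {V : Type*} [Fintype V] {M : Matrix V V ℝ}

/-- In a matrix of rank at most `3` every `4 × 4` minor, here with rows `a b c d` and columns
`e f g k`, vanishes. -/
lemma minor_four_eq_zero (h : M.rank ≤ 3) (a b c d e f g k : V) :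
    M a e * (M b f * (M c g * M d k - M c k * M d g) - M b g * (M c f * M d k - M c k * M d f) +
        M b k * (M c f * M d g - M c g * M d f)) -
      M a f * (M b e * (M c g * M d k - M c k * M d g) - M b g * (M c e * M d k - M c k * M d e) +
        M b k * (M c e * M d g - M c g * M d e)) +
      M a g * (M b e * (M c f * M d k - M c k * M d f) - M b f * (M c e * M d k - M c k * M d e) +
        M b k * (M c e * M d f - M c f * M d e)) -
      M a k * (M b e * (M c f * M d g - M c g * M d f) - M b f * (M c e * M d g - M c g * M d e) +
        M b g * (M c e * M d f - M c f * M d e)) = 0 := by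
  have hdet : (M.submatrix ![a, b, c, d] ![e, f, g, k]).det = 0 := by
    by_contra hne
    have := Matrix.rank_of_det_ne_zero hne
    rw [Fintype.card_fin] at this
    have := Matrix.rank_submatrix_le M ![a, b, c, d] ![e, f, g, k]
    omega
  rw [← hdet, Matrix.det_succ_row_zero, Fin.sum_univ_four]
  simp only [Matrix.det_fin_three, Matrix.submatrix_apply, Fin.succAbove]
  simp
  ring

lemma three_le_rank_of_minor_ne_zero (a b c e f g : V)
    (h : M a e * (M b f * M c g - M b g * M c f) - M a f * (M b e * M c g - M b g * M c e) +
      M a g * (M b e * M c f - M b f * M c e) ≠ 0) : 3 ≤ M.rank := by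
  have hdet : (M.submatrix ![a, b, c] ![e, f, g]).det ≠ 0 := by
    rw [Matrix.det_fin_three]
    simp only [Matrix.submatrix_apply, Matrix.cons_val]
    convert h using 1
    ring
  have h1 := Matrix.rank_of_det_ne_zero hdet
  rw [Fintype.card_fin] at h1
  exact h1.ge.trans <| Matrix.rank_submatrix_le M ![a, b, c] ![e, f, g]

lemma rank_le_of_rows_eq_sum {k : ℕ} (e : Fin k → V)
    (h : ∀ w, ∃ c : Fin k → ℝ, ∀ v, M w v = ∑ i, c i * M (e i) v) : M.rank ≤ k := by
  choose C hC using h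
  have : M = Matrix.of C * M.submatrix e id := by
    ext w v
    rw [hC, Matrix.mul_apply]
    rfl
  rw [this]
  exact (Matrix.rank_mul_le_left _ _).trans
    ((Matrix.rank_le_card_width _).trans_eq (Fintype.card_fin k))

end Minors

/-! ### Independence number two -/

section Graph

variable {V : Type*} {G : SimpleGraph V}

lemma adj_of_indepNum_eq_two [Finite V] (h : G.indepNum = 2) {a b c : V} (hab : a ≠ b) (hac : a ≠ c)
    (hbc : b ≠ c) : G.Adj a b ∨ G.Adj a c ∨ G.Adj b c := by
  classical
  by_contra! hcon
  obtain ⟨h1, h2, h3⟩ := hcon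
  have hi : G.IsIndepSet (({a, b, c} : Finset V) : Set V) := by
    intro x hx y hy hxy
    simp only [Finset.coe_insert, Finset.coe_singleton, Set.mem_insert_iff,
      Set.mem_singleton_iff] at hx hy
    rcases hx with rfl | rfl | rfl <;> rcases hy with rfl | rfl | rfl <;>
      first | exact absurd rfl hxy | assumption | (rw [G.adj_comm]; assumption)
  have := Fintype.ofFinite V
  have := hi.card_le_indepNum
  rw [h, Finset.card_eq_three.2 ⟨a, b, c, hab, hac, hbc, rfl⟩] at this
  omega

lemma exists_not_adj_of_indepNum_eq_two [Finite V] (h : G.indepNum = 2) :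
    ∃ a b, a ≠ b ∧ ¬ G.Adj a b := by
  have := Fintype.ofFinite V
  obtain ⟨s, hs⟩ := G.exists_isNIndepSet_indepNum
  have hc := hs.card_eq
  rw [h] at hc
  classical
  obtain ⟨a, b, hab, rfl⟩ := Finset.card_eq_two.1 hc
  exact ⟨a, b, hab, hs.isIndepSet (by simp) (by simp) hab⟩

lemma indepNum_eq_two [Finite V] {a b : V} (hab : a ≠ b) (h : ¬ G.Adj a b)
    (h3 : ∀ a b c, a ≠ b → a ≠ c → b ≠ c → G.Adj a b ∨ G.Adj a c ∨ G.Adj b c) :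
    G.indepNum = 2 := by
  classical
  have := Fintype.ofFinite V
  apply le_antisymm
  · obtain ⟨s, hs⟩ := G.exists_isNIndepSet_indepNum
    by_contra! hlt
    rw [← hs.card_eq, Finset.two_lt_card] at hlt
    obtain ⟨x, hx, y, hy, z, hz, hxy, hxz, hyz⟩ := hlt
    rcases h3 x y z hxy hxz hyz with h' | h' | h'
    · exact hs.isIndepSet hx hy hxy h'
    · exact hs.isIndepSet hx hz hxz h'
    · exact hs.isIndepSet hy hz hyz h'
  · have hi : G.IsIndepSet (({a, b} : Finset V) : Set V) := by
      intro x hx y hy hxy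
      simp only [Finset.coe_insert, Finset.coe_singleton, Set.mem_insert_iff,
        Set.mem_singleton_iff] at hx hy
      rcases hx with rfl | rfl <;> rcases hy with rfl | rfl <;>
        first | exact absurd rfl hxy | assumption | (rw [G.adj_comm]; assumption)
    have := hi.card_le_indepNum
    rwa [Finset.card_pair hab] at this

/-- A cograph closes every path on four vertices: if `a ~ b ~ c ~ d` then one of the three
remaining pairs is adjacent. -/
lemma IsCograph.adj_of_path (hG : IsCograph G) {a b c d : V} (hab : G.Adj a b) (hbc : G.Adj b c)
    (hcd : G.Adj c d) (had : a ≠ d) : G.Adj a c ∨ G.Adj a d ∨ G.Adj b d := by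
  by_contra! hcon
  obtain ⟨h1, h2, h3⟩ := hcon
  have hac : a ≠ c := by rintro rfl; exact h2 hcd
  have hbd : b ≠ d := by rintro rfl; exact h2 hab
  refine hG ⟨⟨⟨![a, b, c, d], ?_⟩, ?_⟩⟩
  · intro i j hij
    fin_cases i <;> fin_cases j <;>
      simp_all [hab.ne, hbc.ne, hcd.ne, hab.ne', hbc.ne', hcd.ne', hac.symm, had.symm, hbd.symm]
  · intro i j
    change G.Adj (![a, b, c, d] i) (![a, b, c, d] j) ↔ _
    rw [pathGraph_adj]
    fin_cases i <;> fin_cases j <;>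
      simp_all [hab.symm, hbc.symm, hcd.symm, G.adj_comm c a, G.adj_comm d a, G.adj_comm d b]

end Graph

section Class

variable {V : Type*} [Fintype V] [DecidableEq V] {G : SimpleGraph V} [DecidableRel G.Adj]

omit [DecidableEq V] in
lemma degree_pos_of_connected (hc : G.Connected) (hn : 5 ≤ Fintype.card V) (v : V) :
    0 < G.degree v := by
  have : Nontrivial V := Fintype.one_lt_card_iff_nontrivial.1 (by omega)
  exact hc.preconnected.degree_pos_of_nontrivial v

lemma InClassG.exists_rank_eq (h : InClassG G) : ∃ c, (adjAddDegMatrix G c).rank = 3 := by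
  obtain ⟨θ, hθ⟩ := h.exists_eigenvalue
  refine ⟨θ - 1, ?_⟩
  have := normLapMultiplicity_add_rank (degree_pos_of_connected h.connected h.five_le_card) θ
  have := h.five_le_card
  omega

lemma inClassG_of_rank_eq (hn : 5 ≤ Fintype.card V) (hc : G.Connected) {c : ℝ}
    (h : (adjAddDegMatrix G c).rank = 3) : InClassG G := by
  refine ⟨hn, hc, c + 1, ?_⟩
  have := normLapMultiplicity_add_rank (degree_pos_of_connected hc hn) (c + 1)
  rw [add_sub_cancel_right, h] at this
  omega

end Class

/-! ### Diameter three -/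

section FourChain

variable {V : Type*}

/-- Distinct vertices are adjacent exactly when their levels differ by at most one. -/
def IsLevelFunction (G : SimpleGraph V) (lev : V → ℕ) : Prop :=
  ∀ x y, G.Adj x y ↔ x ≠ y ∧ lev x ≤ lev y + 1 ∧ lev y ≤ lev x + 1

/-- `lev` exhibits `G` as a chain of cliques `{u}, X, Y, {v}` with `p ∈ X` and `q ∈ Y`. -/
structure IsFourChain (G : SimpleGraph V) (lev : V → ℕ) (u p q v : V) : Prop where
  adj_iff : IsLevelFunction G lev
  le_three : ∀ x, lev x ≤ 3
  eq_zero_iff : ∀ x, lev x = 0 ↔ x = u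
  eq_three_iff : ∀ x, lev x = 3 ↔ x = v
  level_p : lev p = 1
  level_q : lev q = 2

/-- The vertex set is partitioned into the cliques `N[u]` and `N[v]`. -/
structure IsClosedNeighborPartition (G : SimpleGraph V) (u v : V) : Prop where
  ne : u ≠ v
  not_adj : ¬ G.Adj u v
  cover : ∀ x, x ≠ u → x ≠ v → G.Adj u x ∨ G.Adj v x
  disjoint : ∀ x, G.Adj u x → ¬ G.Adj v x
  clique_left : ∀ x y, G.Adj u x → G.Adj u y → x ≠ y → G.Adj x y
  clique_right : ∀ x y, G.Adj v x → G.Adj v y → x ≠ y → G.Adj x y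

namespace IsClosedNeighborPartition

lemma symm {G : SimpleGraph V} {u v : V} (h : IsClosedNeighborPartition G u v) :
    IsClosedNeighborPartition G v u :=
  ⟨h.ne.symm, fun h' => h.not_adj h'.symm, fun x h1 h2 => (h.cover x h2 h1).symm,
    fun x h1 h2 => h.disjoint x h2 h1, h.clique_right, h.clique_left⟩

variable [Fintype V] [DecidableEq V] {G : SimpleGraph V} [DecidableRel G.Adj] {u v : V}

lemma degree_lt_of_adj (h : IsClosedNeighborPartition G u v) {x y : V} (hx : G.Adj u x)
    (hy : G.Adj v y) (hxy : G.Adj x y) : G.degree u < G.degree x := by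
  have hsub : insert y (insert u ((G.neighborFinset u).erase x)) ⊆ G.neighborFinset x := by
    intro w hw
    simp only [Finset.mem_insert, Finset.mem_erase, mem_neighborFinset] at hw ⊢
    rcases hw with rfl | rfl | ⟨h1, h2⟩
    · exact hxy
    · exact hx.symm
    · exact h.clique_left _ _ hx h2 (Ne.symm h1)
  have hyu : ¬ G.Adj u y := fun h' => h.disjoint y h' hy
  have hyu' : y ≠ u := by rintro rfl; exact h.not_adj hy.symm
  have hc := Finset.card_le_card hsub
  rw [Finset.card_insert_of_notMem (by simp [hyu, hyu']),
    Finset.card_insert_of_notMem (by simp), Finset.card_erase_of_mem (by simpa using hx),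
    card_neighborFinset_eq_degree, card_neighborFinset_eq_degree] at hc
  omega

lemma degree_eq_of_forall_not_adj (h : IsClosedNeighborPartition G u v) {p q : V}
    (hp : G.Adj u p) (hq : G.Adj v q) (hpq : G.Adj p q) (hX : ∀ x, G.Adj u x → G.Adj x q → x = p) :
    G.degree q = G.degree v + 1 := by
  have hN : G.neighborFinset q = insert p (insert v ((G.neighborFinset v).erase q)) := by
    ext w
    simp only [Finset.mem_insert, Finset.mem_erase, mem_neighborFinset]
    constructor
    · intro hw
      by_cases hwv : w = v
      · exact .inr (.inl hwv)
      have hwu : w ≠ u := by rintro rfl; exact h.disjoint q hw.symm hq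
      rcases h.cover w hwu hwv with h1 | h1
      · exact .inl (hX w h1 hw.symm)
      · exact .inr (.inr ⟨hw.ne', h1⟩)
    · rintro (rfl | rfl | ⟨h1, h2⟩)
      · exact hpq.symm
      · exact hq.symm
      · exact h.clique_right _ _ hq h2 (Ne.symm h1)
  have hpv : ¬ G.Adj v p := h.disjoint p hp
  have hpv' : p ≠ v := by rintro rfl; exact h.not_adj hp
  have := (G.degree_pos_iff_exists_adj v).2 ⟨q, hq⟩
  rw [← card_neighborFinset_eq_degree, hN, Finset.card_insert_of_notMem (by simp [hpv, hpv']),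
    Finset.card_insert_of_notMem (by simp), Finset.card_erase_of_mem (by simpa using hq),
    card_neighborFinset_eq_degree]
  omega

lemma degree_eq_of_forall_adj (h : IsClosedNeighborPartition G u v) {p : V}
    (hp : G.Adj u p) (hY : ∀ y, G.Adj v y → G.Adj p y) :
    G.degree p = G.degree u + G.degree v := by
  have hN : G.neighborFinset p =
      insert u ((G.neighborFinset u).erase p) ∪ G.neighborFinset v := by
    ext w
    simp only [Finset.mem_union, Finset.mem_insert, Finset.mem_erase, mem_neighborFinset]
    constructor
    · intro hw
      by_cases hwu : w = u
      · exact .inl (.inl hwu)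
      have hwv : w ≠ v := by rintro rfl; exact h.disjoint p hp hw.symm
      rcases h.cover w hwu hwv with h1 | h1
      · exact .inl (.inr ⟨hw.ne', h1⟩)
      · exact .inr h1
    · rintro ((rfl | ⟨h1, h2⟩) | h1)
      · exact hp.symm
      · exact h.clique_left _ _ hp h2 (Ne.symm h1)
      · exact hY w h1
  have hdisj : Disjoint (insert u ((G.neighborFinset u).erase p)) (G.neighborFinset v) := by
    rw [Finset.disjoint_left]
    intro w hw hwv
    simp only [Finset.mem_insert, Finset.mem_erase, mem_neighborFinset] at hw hwv
    rcases hw with rfl | ⟨-, h2⟩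
    · exact h.not_adj hwv.symm
    · exact h.disjoint w h2 hwv
  have := (G.degree_pos_iff_exists_adj u).2 ⟨p, hp⟩
  rw [← card_neighborFinset_eq_degree, hN, Finset.card_union_of_disjoint hdisj,
    Finset.card_insert_of_notMem (by simp), Finset.card_erase_of_mem (by simpa using hp),
    card_neighborFinset_eq_degree, card_neighborFinset_eq_degree]
  omega

variable {c : ℝ}

/-- The vanishing principal minor on the induced path `u p q v`. -/
lemma path_minor (h : IsClosedNeighborPartition G u v)
    (hr : (adjAddDegMatrix G c).rank ≤ 3) {p q : V} (hp : G.Adj u p) (hq : G.Adj v q)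
    (hpq : G.Adj p q) :
    c * G.degree u * (c * G.degree p * (c * G.degree q * (c * G.degree v) - 1) -
      c * G.degree v) - (c * G.degree q * (c * G.degree v) - 1) = 0 := by
  have huq : ¬ G.Adj u q := fun h' => h.disjoint q h' hq
  have huq' : u ≠ q := by rintro rfl; exact h.not_adj hq.symm
  have hpv : ¬ G.Adj p v := fun h' => h.disjoint p hp h'.symm
  have hpv' : p ≠ v := by rintro rfl; exact h.not_adj hp
  have := minor_four_eq_zero hr u p q v u p q v
  simp only [adjAddDegMatrix_self, adjAddDegMatrix_adj c hp, adjAddDegMatrix_adj c hp.symm,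
    adjAddDegMatrix_adj c hq, adjAddDegMatrix_adj c hq.symm, adjAddDegMatrix_adj c hpq,
    adjAddDegMatrix_adj c hpq.symm, adjAddDegMatrix_not_adj c huq' huq,
    adjAddDegMatrix_not_adj c h.ne h.not_adj, adjAddDegMatrix_not_adj c hpv' hpv,
    adjAddDegMatrix_symm c q u, adjAddDegMatrix_symm c v u, adjAddDegMatrix_symm c v p] at this
  linarith

lemma coeff_ne_zero (h : IsClosedNeighborPartition G u v)
    (hr : (adjAddDegMatrix G c).rank ≤ 3) {p q : V} (hp : G.Adj u p) (hq : G.Adj v q)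
    (hpq : G.Adj p q) : c ≠ 0 := by
  rintro rfl
  have := h.path_minor hr hp hq hpq
  norm_num at this

/-- Bordering the invertible `3 × 3` block with rows `u p q` and columns `p q v` by a further
vertex `x ∈ N(u)` not adjacent to `q`. -/
lemma weight_eq_one_of_not_adj (h : IsClosedNeighborPartition G u v)
    (hr : (adjAddDegMatrix G c).rank ≤ 3) {p q x : V} (hp : G.Adj u p) (hq : G.Adj v q)
    (hpq : G.Adj p q) (hx : G.Adj u x) (hxq : ¬ G.Adj x q) :
    c * G.degree u = 1 ∧ c * G.degree x = 1 := by
  have huq : ¬ G.Adj u q := fun h' => h.disjoint q h' hq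
  have huq' : u ≠ q := by rintro rfl; exact h.not_adj hq.symm
  have hpv : ¬ G.Adj p v := fun h' => h.disjoint p hp h'.symm
  have hpv' : p ≠ v := by rintro rfl; exact h.not_adj hp
  have hxv : ¬ G.Adj x v := fun h' => h.disjoint x hx h'.symm
  have hxv' : x ≠ v := by rintro rfl; exact h.not_adj hx
  have hxq' : x ≠ q := by rintro rfl; exact huq hx
  have hxp : G.Adj x p := h.clique_left _ _ hx hp (by rintro rfl; exact hxq hpq)
  have h1 := minor_four_eq_zero hr u p q x p q v u
  have h2 := minor_four_eq_zero hr u p q x p q v x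
  simp only [adjAddDegMatrix_self, adjAddDegMatrix_adj c hp, adjAddDegMatrix_adj c hp.symm,
    adjAddDegMatrix_adj c hq.symm, adjAddDegMatrix_adj c hpq,
    adjAddDegMatrix_adj c hpq.symm, adjAddDegMatrix_not_adj c huq' huq,
    adjAddDegMatrix_not_adj c h.ne h.not_adj, adjAddDegMatrix_not_adj c hpv' hpv,
    adjAddDegMatrix_symm c q u, adjAddDegMatrix_symm c q x,
    adjAddDegMatrix_adj c hx, adjAddDegMatrix_adj c hx.symm, adjAddDegMatrix_adj c hxp,
    adjAddDegMatrix_adj c hxp.symm, adjAddDegMatrix_not_adj c hxv' hxv,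
    adjAddDegMatrix_not_adj c hxq' hxq] at h1 h2
  constructor <;> linarith

/-- Bordering the same `3 × 3` block by a further vertex `x ∈ N(u)` adjacent to `q`. -/
lemma weight_eq_one_of_adj (h : IsClosedNeighborPartition G u v)
    (hr : (adjAddDegMatrix G c).rank ≤ 3) {p q x : V} (hp : G.Adj u p) (hq : G.Adj v q)
    (hpq : G.Adj p q) (hx : G.Adj u x) (hxq : G.Adj x q) (hne : x ≠ p) :
    c * G.degree p = 1 := by
  have huq : ¬ G.Adj u q := fun h' => h.disjoint q h' hq
  have huq' : u ≠ q := by rintro rfl; exact h.not_adj hq.symm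
  have hpv : ¬ G.Adj p v := fun h' => h.disjoint p hp h'.symm
  have hpv' : p ≠ v := by rintro rfl; exact h.not_adj hp
  have hxv : ¬ G.Adj x v := fun h' => h.disjoint x hx h'.symm
  have hxv' : x ≠ v := by rintro rfl; exact h.not_adj hx
  have hxp : G.Adj x p := h.clique_left _ _ hx hp hne
  have hc := h.coeff_ne_zero hr hp hq hpq
  have hu : (G.degree u : ℝ) ≠ 0 := by
    exact_mod_cast ((G.degree_pos_iff_exists_adj u).2 ⟨p, hp⟩).ne'
  have h1 := minor_four_eq_zero hr u p q x p q v u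
  simp only [adjAddDegMatrix_self, adjAddDegMatrix_adj c hp, adjAddDegMatrix_adj c hp.symm,
    adjAddDegMatrix_adj c hq.symm, adjAddDegMatrix_adj c hpq,
    adjAddDegMatrix_adj c hpq.symm, adjAddDegMatrix_not_adj c huq' huq,
    adjAddDegMatrix_not_adj c h.ne h.not_adj, adjAddDegMatrix_not_adj c hpv' hpv,
    adjAddDegMatrix_symm c q u,
    adjAddDegMatrix_adj c hx.symm, adjAddDegMatrix_adj c hxp,
    adjAddDegMatrix_not_adj c hxv' hxv,
    adjAddDegMatrix_adj c hxq] at h1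
  have h2 : (c * G.degree u) * (c * G.degree p - 1) = 0 := by linarith
  have := (mul_eq_zero.1 h2).resolve_left (mul_ne_zero hc hu)
  linarith

/-- If some `x ∈ N(u)` misses `q`, then `p` is the only neighbour of `q` in `N(u)`. -/
lemma eq_of_adj_of_not_adj (h : IsClosedNeighborPartition G u v)
    (hr : (adjAddDegMatrix G c).rank ≤ 3) {p q x : V} (hp : G.Adj u p) (hq : G.Adj v q)
    (hpq : G.Adj p q) (hx : G.Adj u x) (hxq : ¬ G.Adj x q) :
    ∀ y, G.Adj u y → G.Adj y q → y = p := by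
  intro y hy hyq
  by_contra hne
  have hc := h.coeff_ne_zero hr hp hq hpq
  have h1 := (h.weight_eq_one_of_not_adj hr hp hq hpq hx hxq).1
  have h2 := h.weight_eq_one_of_adj hr hp hq hpq hy hyq hne
  have h3 := h.degree_lt_of_adj hp hq hpq
  have h4 : (G.degree u : ℝ) = G.degree p := mul_left_cancel₀ hc (h1.trans h2.symm)
  have : G.degree u = G.degree p := by exact_mod_cast h4
  omega

/-- An edge `p q` between `N(u)` and `N(v)` forces all of `N(u)` to be adjacent to `q`: otherwise the
degrees of `p` and `q` are determined by those of `u` and `v`, and contradict `path_minor`. -/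
lemma adj_of_adj (h : IsClosedNeighborPartition G u v)
    (hr : (adjAddDegMatrix G c).rank ≤ 3) {p q x : V} (hp : G.Adj u p) (hq : G.Adj v q)
    (hpq : G.Adj p q) (hx : G.Adj u x) : G.Adj x q := by
  by_contra hxq
  have hU := (h.weight_eq_one_of_not_adj hr hp hq hpq hx hxq).1
  have hdq := h.degree_eq_of_forall_not_adj hp hq hpq
    (h.eq_of_adj_of_not_adj hr hp hq hpq hx hxq)
  have hmin := h.path_minor hr hp hq hpq
  have ha : 2 ≤ G.degree u := by
    rw [← card_neighborFinset_eq_degree]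
    exact Finset.one_lt_card.2 ⟨p, by simpa using hp, x, by simpa using hx,
      by rintro rfl; exact hxq hpq⟩
  have hb : 1 ≤ G.degree v := (G.degree_pos_iff_exists_adj v).2 ⟨q, hq⟩
  have ha' : (2 : ℝ) ≤ G.degree u := by exact_mod_cast ha
  have hc := h.coeff_ne_zero hr hp hq hpq
  -- `c` is the inverse of `d_u ≥ 2`, while each case below forces `c ^ 2 = 1`
  have hc2 : c ^ 2 ≠ 1 := by
    intro h1
    have h2 : c ^ 2 * (G.degree u : ℝ) ^ 2 = 1 := by rw [← mul_pow, hU, one_pow]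
    rw [h1] at h2
    nlinarith
  rw [hU, one_mul, hdq] at hmin
  push_cast at hmin
  by_cases hY : ∀ y, G.Adj v y → G.Adj p y
  · have hdp := h.degree_eq_of_forall_adj hp hY
    rw [hdp] at hmin
    push_cast at hmin
    by_cases hy : ∃ y, G.Adj v y ∧ y ≠ q
    · obtain ⟨y, hy, hyq⟩ := hy
      have hQ := h.symm.weight_eq_one_of_adj hr hq hp hpq.symm hy (hY y hy).symm hyq
      rw [hdq] at hQ
      have h5 : (G.degree u : ℝ) = ((G.degree v + 1 : ℕ) : ℝ) :=
        mul_left_cancel₀ hc (hU.trans hQ.symm)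
      rw [mul_add c (G.degree u : ℝ), hU] at hmin
      push_cast at h5 hQ
      rw [hQ] at hmin
      have h6 : c * G.degree v = 1 - c := by linarith
      rw [h6] at hmin
      exact hc2 (by linarith)
    · push Not at hy
      have hb1 : G.degree v = 1 := by
        rw [← card_neighborFinset_eq_degree, Finset.card_eq_one]
        exact ⟨q, by ext y; simp only [mem_neighborFinset, Finset.mem_singleton]
                     exact ⟨hy y, fun h' => h' ▸ hq⟩⟩
      rw [hb1, mul_add c (G.degree u : ℝ), hU] at hmin
      push_cast at hmin
      have h7 : c * (2 * c ^ 2 - 2) = 0 := by linarith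
      have h8 := (mul_eq_zero.1 h7).resolve_left hc
      exact hc2 (by linarith)
  · push Not at hY
    obtain ⟨y, hy, hpy⟩ := hY
    have hpy' : ¬ G.Adj y p := fun h' => hpy h'.symm
    have hV := (h.symm.weight_eq_one_of_not_adj hr hq hp hpq.symm hy hpy').1
    have hdp := h.symm.degree_eq_of_forall_not_adj hq hp hpq.symm
      (h.symm.eq_of_adj_of_not_adj hr hq hp hpq.symm hy hpy')
    rw [hdp] at hmin
    push_cast at hmin
    rw [mul_add c (G.degree u : ℝ), hU, mul_add c (G.degree v : ℝ), hV] at hmin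
    exact hc2 (by linarith)

lemma exists_isFourChain (h : IsClosedNeighborPartition G u v)
    (hr : (adjAddDegMatrix G c).rank ≤ 3) {p q : V} (hp : G.Adj u p) (hq : G.Adj v q)
    (hpq : G.Adj p q) : ∃ lev, IsFourChain G lev u p q v := by
  have hXY : ∀ x y, G.Adj u x → G.Adj v y → G.Adj x y := fun x y hx hy =>
    h.adj_of_adj hr hp hy (h.symm.adj_of_adj hr hq hp hpq.symm hy).symm hx
  have huv := h.ne
  refine ⟨fun w => if w = u then 0 else if w = v then 3 else if G.Adj u w then 1 else 2,
    ?_, ?_, ?_, ?_, ?_, ?_⟩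
  · intro x y
    have key : ∀ z, z = u ∨ z = v ∨ (z ≠ u ∧ z ≠ v ∧ G.Adj u z ∧ ¬ G.Adj v z) ∨
        (z ≠ u ∧ z ≠ v ∧ ¬ G.Adj u z ∧ G.Adj v z) := by
      intro z
      by_cases h1 : z = u
      · exact .inl h1
      by_cases h2 : z = v
      · exact .inr (.inl h2)
      rcases h.cover z h1 h2 with h3 | h3
      · exact .inr (.inr (.inl ⟨h1, h2, h3, h.disjoint z h3⟩))
      · exact .inr (.inr (.inr ⟨h1, h2, h.symm.disjoint z h3, h3⟩))
    have hna := h.not_adj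
    have hna' : ¬ G.Adj v u := fun h' => hna h'.symm
    rcases key x with rfl | rfl | ⟨a1, a2, a3, a4⟩ | ⟨a1, a2, a3, a4⟩ <;>
    rcases key y with rfl | rfl | ⟨b1, b2, b3, b4⟩ | ⟨b1, b2, b3, b4⟩
    · simp
    · simp [huv, huv.symm, hna]
    · simp [b1, b1.symm, b2, b3]
    · simp [b1, b1.symm, b2, b3]
    · simp [huv.symm, hna']
    · simp
    · simp [b1, b2, b3, b4, huv.symm]
    · simp [b1, b2, b2.symm, b3, b4, huv.symm]
    · simp [a1, a2, a3, a3.symm]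
    · simp [a1, a2, a3, G.adj_comm x, a4, huv.symm]
    · simp only [a1, a2, a3, b1, b2, b3, if_true, if_false]
      simpa using ⟨fun h' => h'.ne, fun h' => h.clique_left _ _ a3 b3 h'⟩
    · simp only [a1, a2, a3, b1, b2, b3, if_true, if_false]
      have := hXY x y a3 b4
      simp [this, this.ne]
    · simp [a1, a2, a3, G.adj_comm x]
    · simp [a1, a2, a3, a4.symm, huv.symm]
    · simp only [a1, a2, a3, b1, b2, b3, if_true, if_false]
      have := (hXY y x b3 a4).symm
      simp [this, this.ne]
    · simp only [a1, a2, a3, b1, b2, b3, if_false]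
      simpa using ⟨fun h' => h'.ne, fun h' => h.clique_right _ _ a4 b4 h'⟩
  · intro x
    split_ifs <;> omega
  · intro x
    split_ifs <;> simp_all
  · intro x
    split_ifs <;> simp_all
  · have hpv' : p ≠ v := by rintro rfl; exact h.not_adj hp
    simp [hp.ne', hpv', hp]
  · have huq' : q ≠ u := by rintro rfl; exact h.not_adj hq.symm
    simp [hq.ne', huq', h.symm.disjoint q hq]

end IsClosedNeighborPartition

/-- When the independence number is `2`, the closed neighbourhoods of the ends `u`, `v` of a
diametral path of length `3` are disjoint cliques covering the graph. -/
lemma exists_isClosedNeighborPartition [Finite V] {G : SimpleGraph V} (hα : G.indepNum = 2)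
    (hd : G.diam = 3) :
    ∃ u p q v, IsClosedNeighborPartition G u v ∧ G.Adj u p ∧ G.Adj v q ∧ G.Adj p q := by
  have hnt : Nontrivial V := nontrivial_of_diam_ne_zero (by omega : G.diam ≠ 0)
  have hconn : G.Connected := connected_iff_diam_ne_zero.2 (by omega)
  obtain ⟨u, v, huv⟩ := G.exists_dist_eq_diam
  rw [hd] at huv
  have hle : ∀ w : G.Walk u v, 3 ≤ w.length := fun w => huv ▸ dist_le w
  have hne : u ≠ v := by
    rintro rfl
    simp at huv
  have hna : ¬ G.Adj u v := fun h => by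
    have := hle (.cons h .nil)
    simp at this
  have hdisj : ∀ x, G.Adj u x → ¬ G.Adj v x := fun x h1 h2 => by
    have := hle (.cons h1 (.cons h2.symm .nil))
    simp at this
  obtain ⟨w, hw⟩ := hconn.exists_walk_length_eq_dist u v
  rw [huv] at hw
  have h0 := w.adj_getVert_succ (i := 0) (by omega)
  have h1 := w.adj_getVert_succ (i := 1) (by omega)
  have h2 := w.adj_getVert_succ (i := 2) (by omega)
  have h3 : w.getVert 3 = v := by rw [← hw, w.getVert_length]
  simp only [Nat.reduceAdd, Walk.getVert_zero, h3] at h0 h1 h2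
  refine ⟨u, _, _, v, ⟨hne, hna, ?_, hdisj, ?_, ?_⟩, h0, h2.symm, h1⟩
  · intro x hx1 hx2
    rcases adj_of_indepNum_eq_two hα hne hx1.symm hx2.symm with h | h | h
    · exact absurd h hna
    · exact .inl h
    · exact .inr h
  · intro x y hx hy hxy
    have hxv : v ≠ x := by rintro rfl; exact hna hx
    have hyv : v ≠ y := by rintro rfl; exact hna hy
    rcases adj_of_indepNum_eq_two hα hxv hyv hxy with h | h | h
    · exact absurd h (hdisj x hx)
    · exact absurd h (hdisj y hy)
    · exact h
  · intro x y hx hy hxy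
    have hxv : u ≠ x := by rintro rfl; exact hna hx.symm
    have hyv : u ≠ y := by rintro rfl; exact hna hy.symm
    rcases adj_of_indepNum_eq_two hα hxv hyv hxy with h | h | h
    · exact absurd hx (hdisj x h)
    · exact absurd hy (hdisj y h)
    · exact h

end FourChain

/-! ### Level functions and the graphs `G₁(a, b)` -/

section LevelFunction

variable {V W : Type*} {G : SimpleGraph V} {H : SimpleGraph W}

lemma IsLevelFunction.comap {lev : W → ℕ} (h : IsLevelFunction H lev) (φ : G ≃g H) :
    IsLevelFunction G (lev ∘ φ) := by
  intro x y
  rw [← φ.map_adj_iff, h, φ.injective.ne_iff]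
  rfl

lemma IsLevelFunction.nonempty_iso [Fintype V] [Fintype W] {lev : V → ℕ} {lev' : W → ℕ}
    (hG : IsLevelFunction G lev) (hH : IsLevelFunction H lev')
    (hcard : ∀ k, Finset.card {x | lev x = k} = Finset.card {y | lev' y = k}) :
    Nonempty (G ≃g H) := by
  let e : ∀ k, {x // lev x = k} ≃ {y // lev' y = k} := fun k =>
    Fintype.equivOfCardEq (by rw [Fintype.card_subtype, Fintype.card_subtype, hcard])
  refine ⟨⟨Equiv.ofFiberEquiv e, ?_⟩⟩
  intro x y
  rw [hG, hH, (Equiv.ofFiberEquiv e).injective.ne_iff,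
    Equiv.ofFiberEquiv_map (f := lev) (g := lev'), Equiv.ofFiberEquiv_map (f := lev) (g := lev')]

lemma IsLevelFunction.level_le_add_length {lev : V → ℕ} (h : IsLevelFunction G lev) {x y : V}
    (w : G.Walk x y) : lev y ≤ lev x + w.length := by
  induction w with
  | nil => simp
  | cons hadj w ih =>
    have := ((h _ _).1 hadj).2.2
    rw [Walk.length_cons]
    omega

end LevelFunction

namespace IsFourChain

variable {V : Type*} {G : SimpleGraph V} {lev : V → ℕ} {u p q v : V}

lemma level_u (h : IsFourChain G lev u p q v) : lev u = 0 := (h.eq_zero_iff u).2 rfl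

lemma level_v (h : IsFourChain G lev u p q v) : lev v = 3 := (h.eq_three_iff v).2 rfl

lemma edist_le_three (h : IsFourChain G lev u p q v) (x y : V) : G.edist x y ≤ 3 := by
  have hpq : G.Adj p q := by
    rw [h.adj_iff, h.level_p, h.level_q]
    refine ⟨?_, by omega, by omega⟩
    rintro rfl
    have := h.level_p
    have := h.level_q
    omega
  have key : ∀ x, ∃ m, (m = p ∨ m = q) ∧ G.edist x m ≤ 1 := by
    intro x
    have h3 := h.le_three x
    have hp := h.level_p
    have hq := h.level_q
    by_cases hx : lev x ≤ 1
    · refine ⟨p, .inl rfl, edist_le_one_iff_adj_or_eq.2 ?_⟩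
      rw [or_iff_not_imp_right, h.adj_iff]
      exact fun hne => ⟨hne, by omega, by omega⟩
    · refine ⟨q, .inr rfl, edist_le_one_iff_adj_or_eq.2 ?_⟩
      rw [or_iff_not_imp_right, h.adj_iff]
      exact fun hne => ⟨hne, by omega, by omega⟩
  obtain ⟨m, hm, hxm⟩ := key x
  obtain ⟨m', hm', hym⟩ := key y
  have hmm : G.edist m m' ≤ 1 := by
    rw [edist_le_one_iff_adj_or_eq]
    rcases hm with rfl | rfl <;> rcases hm' with rfl | rfl <;> simp [hpq, hpq.symm]
  calc G.edist x y ≤ G.edist x m + G.edist m y := SimpleGraph.edist_triangle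
    _ ≤ G.edist x m + (G.edist m m' + G.edist m' y) := by gcongr; exact SimpleGraph.edist_triangle
    _ ≤ 1 + (1 + 1) := by
      rw [edist_comm (u := m')]
      gcongr
    _ = 3 := by norm_num

lemma ediam_ne_top (h : IsFourChain G lev u p q v) : G.ediam ≠ ⊤ :=
  ne_top_of_le_ne_top (by simp) (ediam_le_of_edist_le h.edist_le_three)

lemma connected (h : IsFourChain G lev u p q v) : G.Connected :=
  have : Nonempty V := ⟨u⟩
  connected_of_ediam_ne_top h.ediam_ne_top

lemma diam_eq_three (h : IsFourChain G lev u p q v) : G.diam = 3 := by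
  apply le_antisymm
  · have : G.ediam ≤ ((3 : ℕ) : ℕ∞) := ediam_le_of_edist_le h.edist_le_three
    exact ENat.toNat_le_of_le_natCast this
  · refine le_trans ?_ (dist_le_diam h.ediam_ne_top (u := u) (v := v))
    obtain ⟨w, hw⟩ := h.connected.exists_walk_length_eq_dist u v
    have := h.adj_iff.level_le_add_length w
    rw [h.level_u, h.level_v] at this
    omega

lemma indepNum_eq [Finite V] (h : IsFourChain G lev u p q v) : G.indepNum = 2 := by
  have hu := h.level_u
  have hv := h.level_v
  refine indepNum_eq_two (a := u) (b := v) ?_ ?_ ?_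
  · rintro rfl
    omega
  · rw [h.adj_iff]
    omega
  · intro a b c hab hac hbc
    have ha := h.le_three a
    have hb := h.le_three b
    have hc := h.le_three c
    simp only [h.adj_iff _ _, hab, hac, hbc, ne_eq, not_false_eq_true, true_and]
    omega

variable [Fintype V]

lemma card_level_zero (h : IsFourChain G lev u p q v) : Finset.card {x | lev x = 0} = 1 := by
  rw [Finset.card_eq_one]
  exact ⟨u, by ext x; simp [h.eq_zero_iff]⟩

lemma card_level_three (h : IsFourChain G lev u p q v) : Finset.card {x | lev x = 3} = 1 := by
  rw [Finset.card_eq_one]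
  exact ⟨v, by ext x; simp [h.eq_three_iff]⟩

lemma card_add_card (h : IsFourChain G lev u p q v) :
    Finset.card {x | lev x = 1} + Finset.card {x | lev x = 2} + 2 = Fintype.card V := by
  have := Finset.card_eq_sum_card_fiberwise (f := lev) (s := Finset.univ) (t := Finset.range 4)
    (fun x _ => by have := h.le_three x; simp; omega)
  rw [Finset.card_univ] at this
  simp only [Finset.sum_range_succ, Finset.sum_range_zero, h.card_level_zero,
    h.card_level_three] at this
  omega

lemma nonempty_iso {W : Type*} [Fintype W] {H : SimpleGraph W} {lev' : W → ℕ} {u' p' q' v' : W}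
    (h : IsFourChain G lev u p q v) (h' : IsFourChain H lev' u' p' q' v')
    (hcard : Fintype.card V = Fintype.card W)
    (h1 : Finset.card {x | lev x = 1} = Finset.card {x | lev' x = 1}) : Nonempty (G ≃g H) := by
  refine h.adj_iff.nonempty_iso h'.adj_iff fun k => ?_
  have e1 := h.card_add_card
  have e2 := h'.card_add_card
  match k with
  | 0 => rw [h.card_level_zero, h'.card_level_zero]
  | 1 => exact h1
  | 2 => omega
  | 3 => rw [h.card_level_three, h'.card_level_three]
  | k + 4 =>
    have e : ({x | lev x = k + 4} : Finset V) = ∅ :=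
      Finset.filter_eq_empty_iff.2 fun x _ => by have := h.le_three x; omega
    have e' : ({x | lev' x = k + 4} : Finset W) = ∅ :=
      Finset.filter_eq_empty_iff.2 fun x _ => by have := h'.le_three x; omega
    rw [e, e', Finset.card_empty, Finset.card_empty]

variable [DecidableRel G.Adj]

lemma neighborFinset_u (h : IsFourChain G lev u p q v) :
    G.neighborFinset u = ({x | lev x = 1} : Finset V) := by
  ext x
  have h0 := h.eq_zero_iff x
  rw [mem_neighborFinset, h.adj_iff, h.level_u, Finset.mem_filter, ne_comm, Ne, ← h0]
  simp only [Finset.mem_univ, true_and]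
  omega

lemma neighborFinset_v (h : IsFourChain G lev u p q v) :
    G.neighborFinset v = ({x | lev x = 2} : Finset V) := by
  ext x
  have h0 := h.eq_three_iff x
  have h3 := h.le_three x
  rw [mem_neighborFinset, h.adj_iff, h.level_v, Finset.mem_filter, ne_comm, Ne, ← h0]
  simp only [Finset.mem_univ, true_and]
  omega

variable [DecidableEq V]

lemma neighborFinset_of_level_one (h : IsFourChain G lev u p q v) {x : V} (hx : lev x = 1) :
    G.neighborFinset x = (Finset.univ.erase v).erase x := by
  ext y
  have h0 := h.eq_three_iff y
  have h3 := h.le_three y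
  have h1 : (1 ≤ lev y + 1 ∧ lev y ≤ 1 + 1) ↔ ¬ lev y = 3 := by omega
  rw [mem_neighborFinset, h.adj_iff, hx, h1, h0, Finset.mem_erase, Finset.mem_erase, ne_comm]
  simp

lemma neighborFinset_of_level_two (h : IsFourChain G lev u p q v) {x : V} (hx : lev x = 2) :
    G.neighborFinset x = (Finset.univ.erase u).erase x := by
  ext y
  have h0 := h.eq_zero_iff y
  have h3 := h.le_three y
  have h1 : (2 ≤ lev y + 1 ∧ lev y ≤ 2 + 1) ↔ ¬ lev y = 0 := by omega
  rw [mem_neighborFinset, h.adj_iff, hx, h1, h0, Finset.mem_erase, Finset.mem_erase, ne_comm]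
  simp

lemma degree_inner (h : IsFourChain G lev u p q v) {x : V} (hx : lev x = 1 ∨ lev x = 2) :
    G.degree x + 2 = Fintype.card V := by
  have hxu : x ≠ u := by rintro rfl; have := h.level_u; omega
  have hxv : x ≠ v := by rintro rfl; have := h.level_v; omega
  have := h.card_add_card
  rcases hx with hx | hx
  · rw [← card_neighborFinset_eq_degree, h.neighborFinset_of_level_one hx,
      Finset.card_erase_of_mem (by simp [hxv]), Finset.card_erase_of_mem (by simp),
      Finset.card_univ]
    omega
  · rw [← card_neighborFinset_eq_degree, h.neighborFinset_of_level_two hx,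
      Finset.card_erase_of_mem (by simp [hxu]), Finset.card_erase_of_mem (by simp),
      Finset.card_univ]
    omega

/-- With `c = 1 / (n - 2)` the entries of `A + c D` depend on the levels only, because
`c d_x = 1` on the two inner levels. -/
lemma adjAddDegMatrix_apply (h : IsFourChain G lev u p q v) {c : ℝ}
    (hc : c * ((Fintype.card V : ℝ) - 2) = 1) (x y : V) :
    adjAddDegMatrix G c x y = if lev x = 0 ∧ lev y = 0 then c * G.degree u else
      if lev x = 3 ∧ lev y = 3 then c * G.degree v else
      if lev x ≤ lev y + 1 ∧ lev y ≤ lev x + 1 then 1 else 0 := by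
  by_cases hxy : x = y
  · subst hxy
    rw [adjAddDegMatrix_self]
    by_cases h0 : lev x = 0
    · rw [if_pos ⟨h0, h0⟩, (h.eq_zero_iff x).1 h0]
    by_cases h3 : lev x = 3
    · rw [if_neg (by simp [h0]), if_pos ⟨h3, h3⟩, (h.eq_three_iff x).1 h3]
    have := h.le_three x
    have hd := h.degree_inner (x := x) (by omega)
    have hd' : (G.degree x : ℝ) = Fintype.card V - 2 := by
      rw [← hd]
      push_cast
      ring
    simp [h0, h3, hd', hc]
  · have h0 : ¬ (lev x = 0 ∧ lev y = 0) := by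
      rw [h.eq_zero_iff, h.eq_zero_iff]
      rintro ⟨rfl, rfl⟩
      exact hxy rfl
    have h3 : ¬ (lev x = 3 ∧ lev y = 3) := by
      rw [h.eq_three_iff, h.eq_three_iff]
      rintro ⟨rfl, rfl⟩
      exact hxy rfl
    rw [if_neg h0, if_neg h3]
    by_cases ha : G.Adj x y
    · rw [adjAddDegMatrix_adj c ha, if_pos ((h.adj_iff x y).1 ha).2]
    · rw [adjAddDegMatrix_not_adj c hxy ha, if_neg]
      exact fun h' => ha ((h.adj_iff x y).2 ⟨hxy, h'⟩)

lemma rank_eq_three (h : IsFourChain G lev u p q v) {c : ℝ}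
    (hc : c * ((Fintype.card V : ℝ) - 2) = 1) : (adjAddDegMatrix G c).rank = 3 := by
  have happ := h.adjAddDegMatrix_apply hc
  have hu := h.level_u
  have hp := h.level_p
  have hq := h.level_q
  have hv := h.level_v
  have hsum : c * G.degree u + c * G.degree v = 1 := by
    rw [← hc, ← h.card_add_card, ← mul_add, ← card_neighborFinset_eq_degree,
      ← card_neighborFinset_eq_degree, h.neighborFinset_u, h.neighborFinset_v]
    push_cast
    ring
  apply le_antisymm
  · -- the rows of `u`, `v` add up to `c d_u` times the row of `p` plus `c d_v` times that of `q`
    refine rank_le_of_rows_eq_sum ![u, p, q] fun w => ?_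
    have hw := h.le_three w
    obtain hw | hw | hw | hw : lev w = 0 ∨ lev w = 1 ∨ lev w = 2 ∨ lev w = 3 := by omega
    · refine ⟨![1, 0, 0], fun y => ?_⟩
      simp only [Fin.sum_univ_three, Matrix.cons_val, one_mul, zero_mul, add_zero, zero_add, happ,
        hw, hu]
    · refine ⟨![0, 1, 0], fun y => ?_⟩
      simp only [Fin.sum_univ_three, Matrix.cons_val, one_mul, zero_mul, add_zero, zero_add, happ,
        hw, hp]
    · refine ⟨![0, 0, 1], fun y => ?_⟩
      simp only [Fin.sum_univ_three, Matrix.cons_val, one_mul, zero_mul, add_zero, zero_add, happ,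
        hw, hq]
    · refine ⟨![-1, c * G.degree u, c * G.degree v], fun y => ?_⟩
      have hy := h.le_three y
      obtain hy | hy | hy | hy : lev y = 0 ∨ lev y = 1 ∨ lev y = 2 ∨ lev y = 3 := by omega
      all_goals simp [Fin.sum_univ_three, happ, hw, hu, hp, hq, hy]
      all_goals linarith
  · apply three_le_rank_of_minor_ne_zero u p q p q v
    simp [happ, hu, hp, hq, hv]

lemma eq_zero_of_sum_neighbor_eq_zero (h : IsFourChain G lev u p q v) {x : V → ℝ}
    (hx : ∀ w, ∑ y ∈ G.neighborFinset w, x y = 0) : x = 0 := by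
  have hu := hx u
  have hv := hx v
  rw [h.neighborFinset_u] at hu
  rw [h.neighborFinset_v] at hv
  have huv : u ≠ v := by rintro rfl; have := h.level_u; have := h.level_v; omega
  have htot : ∑ y, x y = x u + x v := by
    have h1 := Finset.sum_fiberwise_of_maps_to (s := Finset.univ) (t := Finset.range 4)
      (g := lev) (fun y _ => by have := h.le_three y; simp; omega) x
    have e0 : ({y | lev y = 0} : Finset V) = {u} := by ext y; simp [h.eq_zero_iff]
    have e3 : ({y | lev y = 3} : Finset V) = {v} := by ext y; simp [h.eq_three_iff]
    rw [← h1, Finset.sum_range_succ, Finset.sum_range_succ, Finset.sum_range_succ,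
      Finset.sum_range_one, hu, hv, e0, e3, Finset.sum_singleton, Finset.sum_singleton]
    ring
  -- `x` is constant on each inner level, hence vanishes there
  have h1 : ∀ y, lev y = 1 → x y = x u := by
    intro y hy
    have hyv : y ≠ v := by rintro rfl; have := h.level_v; omega
    have := hx y
    rw [h.neighborFinset_of_level_one hy, Finset.sum_erase_eq_sub (by simp [hyv]),
      Finset.sum_erase_eq_sub (by simp), htot] at this
    linarith
  have h2 : ∀ y, lev y = 2 → x y = x v := by
    intro y hy
    have hyu : y ≠ u := by rintro rfl; have := h.level_u; omega
    have := hx y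
    rw [h.neighborFinset_of_level_two hy, Finset.sum_erase_eq_sub (by simp [hyu]),
      Finset.sum_erase_eq_sub (by simp), htot] at this
    linarith
  have hxu : x u = 0 := by
    rw [Finset.sum_congr rfl fun y hy => h1 y (Finset.mem_filter.1 hy).2, Finset.sum_const,
      nsmul_eq_mul] at hu
    refine (mul_eq_zero.1 hu).resolve_left (Nat.cast_ne_zero.2 (Finset.card_ne_zero.2 ⟨p, ?_⟩))
    simp [h.level_p]
  have hxv : x v = 0 := by
    rw [Finset.sum_congr rfl fun y hy => h2 y (Finset.mem_filter.1 hy).2, Finset.sum_const,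
      nsmul_eq_mul] at hv
    refine (mul_eq_zero.1 hv).resolve_left (Nat.cast_ne_zero.2 (Finset.card_ne_zero.2 ⟨q, ?_⟩))
    simp [h.level_q]
  funext y
  have hy := h.le_three y
  obtain hy | hy | hy | hy : lev y = 0 ∨ lev y = 1 ∨ lev y = 2 ∨ lev y = 3 := by omega
  · rw [(h.eq_zero_iff y).1 hy, hxu]; rfl
  · rw [h1 y hy, hxu]; rfl
  · rw [h2 y hy, hxv]; rfl
  · rw [(h.eq_three_iff y).1 hy, hxv]; rfl

lemma inClassG1 (h : IsFourChain G lev u p q v) (hn : 5 ≤ Fintype.card V) : InClassG1 G := by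
  have hne : (Fintype.card V : ℝ) - 2 ≠ 0 := by
    have : (5 : ℝ) ≤ Fintype.card V := by exact_mod_cast hn
    linarith
  have hG := inClassG_of_rank_eq hn h.connected (h.rank_eq_three (inv_mul_cancel₀ hne))
  refine ⟨hG, fun hrho => ?_, h.indepNum_eq⟩
  obtain ⟨x, hx0, hx⟩ := exists_adj_kernel_of_rho_eq_one
    (degree_pos_of_connected h.connected hn) hrho
  exact hx0 (h.eq_zero_of_sum_neighbor_eq_zero hx)

end IsFourChain

lemma isFourChain_graphG1 (a b : ℕ) :
    IsFourChain (graphG1 a b) (graphG1Level a b) (.inl ()) (.inr (.inl 0)) (.inr (.inr (.inl 0)))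
      (.inr (.inr (.inr ()))) where
  adj_iff _ _ := Iff.rfl
  le_three := by rintro (_ | _ | _ | _) <;> simp [graphG1Level]
  eq_zero_iff := by rintro (_ | _ | _ | _) <;> simp [graphG1Level]
  eq_three_iff := by rintro (_ | _ | _ | _) <;> simp [graphG1Level]
  level_p := rfl
  level_q := rfl

lemma card_level_one_graphG1 (a b : ℕ) : Finset.card {x | graphG1Level a b x = 1} = a + 1 := by
  have : ({x | graphG1Level a b x = 1} : Finset _) =
      Finset.univ.map (Function.Embedding.inl.trans Function.Embedding.inr) := by
    ext x
    rw [Finset.mem_filter, Finset.mem_map]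
    rcases x with _ | _ | _ | _ <;> simp [graphG1Level]
  rw [this, Finset.card_map, Finset.card_univ, Fintype.card_fin]

lemma exists_isFourChain_iff {V : Type*} [Fintype V] (G : SimpleGraph V) :
    (∃ lev u p q v, IsFourChain G lev u p q v) ↔
      ∃ a b : ℕ, a + b + 4 = Fintype.card V ∧ Nonempty (G ≃g graphG1 a b) := by
  constructor
  · rintro ⟨lev, u, p, q, v, h⟩
    have h1 : 0 < Finset.card {x | lev x = 1} := Finset.card_pos.2 ⟨p, by simp [h.level_p]⟩
    have h2 : 0 < Finset.card {x | lev x = 2} := Finset.card_pos.2 ⟨q, by simp [h.level_q]⟩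
    have hc := h.card_add_card
    refine ⟨Finset.card {x | lev x = 1} - 1, Finset.card {x | lev x = 2} - 1, by omega,
      h.nonempty_iso (isFourChain_graphG1 _ _) ?_ ?_⟩
    · simp only [Fintype.card_sum, Fintype.card_unit, Fintype.card_fin]
      omega
    · rw [card_level_one_graphG1]
      omega
  · rintro ⟨a, b, -, ⟨φ⟩⟩
    have h := isFourChain_graphG1 a b
    refine ⟨graphG1Level a b ∘ φ, φ.symm (.inl ()), φ.symm (.inr (.inl 0)),
      φ.symm (.inr (.inr (.inl 0))), φ.symm (.inr (.inr (.inr ()))), h.adj_iff.comap φ,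
      fun x => h.le_three _, fun x => ?_, fun x => ?_, ?_, ?_⟩
    · rw [Function.comp_apply, h.eq_zero_iff, φ.eq_symm_apply]
    · rw [Function.comp_apply, h.eq_three_iff, φ.eq_symm_apply]
    · simp [graphG1Level]
    · simp [graphG1Level]

/-! ### Cliques with a pendant vertex -/

/-- `lev` exhibits `G` as a chain of cliques `{w}, {z}, Q`: a clique with a pendant vertex `w`
attached at `z`. -/
structure IsThreeChain {V : Type*} (G : SimpleGraph V) (lev : V → ℕ) (w z : V) : Prop where
  adj_iff : IsLevelFunction G lev
  le_two : ∀ x, lev x ≤ 2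
  eq_zero_iff : ∀ x, lev x = 0 ↔ x = w
  eq_one_iff : ∀ x, lev x = 1 ↔ x = z

namespace IsThreeChain

variable {V : Type*} {G : SimpleGraph V} {lev : V → ℕ} {w z : V}

lemma level_w (h : IsThreeChain G lev w z) : lev w = 0 := (h.eq_zero_iff w).2 rfl

lemma level_z (h : IsThreeChain G lev w z) : lev z = 1 := (h.eq_one_iff z).2 rfl

lemma connected (h : IsThreeChain G lev w z) : G.Connected := by
  have hz := h.level_z
  refine (connected_iff_exists_forall_reachable G).2 ⟨z, fun x => ?_⟩
  by_cases hxz : z = x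
  · rw [hxz]
  · have := h.le_two x
    exact ((h.adj_iff z x).2 ⟨hxz, by omega, by omega⟩).reachable

/-- Two vertices are nonadjacent only if one of them is `w`, which an induced path on four vertices
does not allow. -/
lemma isCograph (h : IsThreeChain G lev w z) : IsCograph G := by
  rintro ⟨f⟩
  have key : ∀ i j : Fin 4, i ≠ j → ¬ (pathGraph 4).Adj i j → f i = w ∨ f j = w := by
    intro i j hij hadj
    rw [← f.map_adj_iff, h.adj_iff, f.injective.ne_iff] at hadj
    rw [← h.eq_zero_iff, ← h.eq_zero_iff]
    have := h.le_two (f i)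
    have := h.le_two (f j)
    have : ¬ (lev (f i) ≤ lev (f j) + 1 ∧ lev (f j) ≤ lev (f i) + 1) := fun h' => hadj ⟨hij, h'⟩
    omega
  have h02 := key 0 2 (by decide) (by simp [pathGraph_adj])
  have h13 := key 1 3 (by decide) (by simp [pathGraph_adj])
  have hne : ∀ i j : Fin 4, i ≠ j → f i = w → f j ≠ w := fun i j hij hi hj =>
    hij (f.injective (hi.trans hj.symm))
  rcases h02 with h0 | h0 <;> rcases h13 with h1 | h1
  · exact hne 0 1 (by decide) h0 h1
  · exact hne 0 3 (by decide) h0 h1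
  · exact hne 2 1 (by decide) h0 h1
  · exact hne 2 3 (by decide) h0 h1

variable [Fintype V]

lemma card_level_zero (h : IsThreeChain G lev w z) : Finset.card {x | lev x = 0} = 1 := by
  rw [Finset.card_eq_one]
  exact ⟨w, by ext x; simp [h.eq_zero_iff]⟩

lemma card_level_one (h : IsThreeChain G lev w z) : Finset.card {x | lev x = 1} = 1 := by
  rw [Finset.card_eq_one]
  exact ⟨z, by ext x; simp [h.eq_one_iff]⟩

lemma card_level_two (h : IsThreeChain G lev w z) :
    Finset.card {x | lev x = 2} + 2 = Fintype.card V := by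
  have := Finset.card_eq_sum_card_fiberwise (f := lev) (s := Finset.univ) (t := Finset.range 3)
    (fun x _ => by have := h.le_two x; simp; omega)
  rw [Finset.card_univ] at this
  simp only [Finset.sum_range_succ, Finset.sum_range_zero, h.card_level_zero,
    h.card_level_one] at this
  omega

lemma nonempty_iso {W : Type*} [Fintype W] {H : SimpleGraph W} {lev' : W → ℕ} {w' z' : W}
    (h : IsThreeChain G lev w z) (h' : IsThreeChain H lev' w' z')
    (hcard : Fintype.card V = Fintype.card W) : Nonempty (G ≃g H) := by
  refine h.adj_iff.nonempty_iso h'.adj_iff fun k => ?_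
  have e1 := h.card_level_two
  have e2 := h'.card_level_two
  match k with
  | 0 => rw [h.card_level_zero, h'.card_level_zero]
  | 1 => rw [h.card_level_one, h'.card_level_one]
  | 2 => omega
  | k + 3 =>
    have e : ({x | lev x = k + 3} : Finset V) = ∅ :=
      Finset.filter_eq_empty_iff.2 fun x _ => by have := h.le_two x; omega
    have e' : ({x | lev' x = k + 3} : Finset W) = ∅ :=
      Finset.filter_eq_empty_iff.2 fun x _ => by have := h'.le_two x; omega
    rw [e, e', Finset.card_empty, Finset.card_empty]

lemma exists_level_two (h : IsThreeChain G lev w z) (hn : 5 ≤ Fintype.card V) :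
    ∃ x, lev x = 2 := by
  have := h.card_level_two
  obtain ⟨x, hx⟩ := Finset.card_pos.1 (show 0 < Finset.card {x | lev x = 2} by omega)
  exact ⟨x, by simpa using hx⟩

lemma indepNum_eq (h : IsThreeChain G lev w z) (hn : 5 ≤ Fintype.card V) : G.indepNum = 2 := by
  have hw := h.level_w
  obtain ⟨x, hx⟩ := h.exists_level_two hn
  refine indepNum_eq_two (a := w) (b := x) ?_ ?_ ?_
  · rintro rfl
    omega
  · rw [h.adj_iff]
    omega
  · intro a b c hab hac hbc
    have ha := h.le_two a
    have hb := h.le_two b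
    have hc := h.le_two c
    have hab' : ¬ (lev a = 0 ∧ lev b = 0) := fun h' =>
      hab (((h.eq_zero_iff a).1 h'.1).trans ((h.eq_zero_iff b).1 h'.2).symm)
    simp only [h.adj_iff _ _, hab, hac, hbc, ne_eq, not_false_eq_true, true_and]
    omega

variable [DecidableRel G.Adj]

lemma neighborFinset_w (h : IsThreeChain G lev w z) : G.neighborFinset w = {z} := by
  ext x
  rw [mem_neighborFinset, h.adj_iff, h.level_w, Finset.mem_singleton, ← h.eq_one_iff, ne_comm, Ne,
    ← h.eq_zero_iff]
  omega

variable [DecidableEq V]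

lemma neighborFinset_z (h : IsThreeChain G lev w z) : G.neighborFinset z = Finset.univ.erase z := by
  ext x
  have := h.le_two x
  rw [mem_neighborFinset, h.adj_iff, h.level_z, Finset.mem_erase, ne_comm]
  simp only [Finset.mem_univ, and_true, and_iff_left_iff_imp]
  omega

lemma neighborFinset_of_level_two (h : IsThreeChain G lev w z) {x : V} (hx : lev x = 2) :
    G.neighborFinset x = (Finset.univ.erase w).erase x := by
  ext y
  have h0 := h.eq_zero_iff y
  have h2 := h.le_two y
  have h1 : (2 ≤ lev y + 1 ∧ lev y ≤ 2 + 1) ↔ ¬ lev y = 0 := by omega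
  rw [mem_neighborFinset, h.adj_iff, hx, h1, h0, Finset.mem_erase, Finset.mem_erase, ne_comm]
  simp

/-- With `c = 1 / (n - 2)` the entries of `A + c D` depend on the levels only. -/
lemma adjAddDegMatrix_apply (h : IsThreeChain G lev w z) {c : ℝ}
    (hc : c * ((Fintype.card V : ℝ) - 2) = 1) (x y : V) :
    adjAddDegMatrix G c x y = if lev x = 0 ∧ lev y = 0 then c else
      if lev x = 1 ∧ lev y = 1 then c + 1 else
      if lev x ≤ lev y + 1 ∧ lev y ≤ lev x + 1 then 1 else 0 := by
  by_cases hxy : x = y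
  · subst hxy
    have := h.le_two x
    have hcard := h.card_level_two
    rw [adjAddDegMatrix_self]
    obtain hx | hx | hx : lev x = 0 ∨ lev x = 1 ∨ lev x = 2 := by omega
    · have hd : G.degree x = 1 := by
        rw [(h.eq_zero_iff x).1 hx, ← card_neighborFinset_eq_degree, h.neighborFinset_w,
          Finset.card_singleton]
      simp [hx, hd]
    · have hd : G.degree x + 1 = Fintype.card V := by
        rw [(h.eq_one_iff x).1 hx, ← card_neighborFinset_eq_degree, h.neighborFinset_z,
          Finset.card_erase_of_mem (by simp), Finset.card_univ]
        omega
      rw [← hd] at hc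
      push_cast at hc
      simp only [hx]
      norm_num
      linarith
    · have hxw : x ≠ w := by rintro rfl; have := h.level_w; omega
      have hd : G.degree x + 2 = Fintype.card V := by
        rw [← card_neighborFinset_eq_degree, h.neighborFinset_of_level_two hx,
          Finset.card_erase_of_mem (by simp [hxw]), Finset.card_erase_of_mem (by simp),
          Finset.card_univ]
        omega
      rw [← hd] at hc
      push_cast at hc
      simp only [hx]
      norm_num
      linarith
  · have h0 : ¬ (lev x = 0 ∧ lev y = 0) := by
      rw [h.eq_zero_iff, h.eq_zero_iff]
      rintro ⟨rfl, rfl⟩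
      exact hxy rfl
    have h1 : ¬ (lev x = 1 ∧ lev y = 1) := by
      rw [h.eq_one_iff, h.eq_one_iff]
      rintro ⟨rfl, rfl⟩
      exact hxy rfl
    rw [if_neg h0, if_neg h1]
    by_cases ha : G.Adj x y
    · rw [adjAddDegMatrix_adj c ha, if_pos ((h.adj_iff x y).1 ha).2]
    · rw [adjAddDegMatrix_not_adj c hxy ha, if_neg]
      exact fun h' => ha ((h.adj_iff x y).2 ⟨hxy, h'⟩)

lemma rank_eq_three (h : IsThreeChain G lev w z) (hn : 5 ≤ Fintype.card V) {c : ℝ}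
    (hc : c * ((Fintype.card V : ℝ) - 2) = 1) : (adjAddDegMatrix G c).rank = 3 := by
  have happ := h.adjAddDegMatrix_apply hc
  have hw := h.level_w
  have hz := h.level_z
  obtain ⟨x, hx⟩ := h.exists_level_two hn
  apply le_antisymm
  · refine rank_le_of_rows_eq_sum ![w, z, x] fun v => ?_
    have hv := h.le_two v
    obtain hv | hv | hv : lev v = 0 ∨ lev v = 1 ∨ lev v = 2 := by omega
    · refine ⟨![1, 0, 0], fun y => ?_⟩
      simp only [Fin.sum_univ_three, Matrix.cons_val, one_mul, zero_mul, add_zero, happ, hv, hw]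
    · refine ⟨![0, 1, 0], fun y => ?_⟩
      simp only [Fin.sum_univ_three, Matrix.cons_val, one_mul, zero_mul, add_zero, zero_add, happ,
        hv, hz]
    · refine ⟨![0, 0, 1], fun y => ?_⟩
      simp only [Fin.sum_univ_three, Matrix.cons_val, one_mul, zero_mul, add_zero, zero_add, happ,
        hv, hx]
  · apply three_le_rank_of_minor_ne_zero w z x w z x
    have hn' : (5 : ℝ) ≤ Fintype.card V := by exact_mod_cast hn
    simp only [happ, hw, hz, hx]
    norm_num
    -- the minor is `c ^ 2 - 1` with `0 < c ≤ 1 / 3`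
    intro hcon
    have hc1 : c ^ 2 = 1 := by linarith
    have h2 : c ^ 2 * ((Fintype.card V : ℝ) - 2) ^ 2 = 1 := by rw [← mul_pow, hc, one_pow]
    rw [hc1] at h2
    nlinarith

lemma eq_zero_of_sum_neighbor_eq_zero (h : IsThreeChain G lev w z) (hn : 5 ≤ Fintype.card V)
    {x : V → ℝ} (hx : ∀ v, ∑ y ∈ G.neighborFinset v, x y = 0) : x = 0 := by
  have hxz : x z = 0 := by
    have := hx w
    rwa [h.neighborFinset_w, Finset.sum_singleton] at this
  have htot : ∑ y, x y = 0 := by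
    have := hx z
    rwa [h.neighborFinset_z, Finset.sum_erase _ hxz] at this
  have h2 : ∀ y, lev y = 2 → x y = -x w := by
    intro y hy
    have hyw : y ≠ w := by rintro rfl; have := h.level_w; omega
    have := hx y
    rw [h.neighborFinset_of_level_two hy, Finset.sum_erase_eq_sub (by simp [hyw]),
      Finset.sum_erase_eq_sub (by simp), htot] at this
    linarith
  have hxw : x w = 0 := by
    have h1 := Finset.sum_fiberwise_of_maps_to (s := Finset.univ) (t := Finset.range 3)
      (g := lev) (fun y _ => by have := h.le_two y; simp; omega) x
    have e0 : ({y | lev y = 0} : Finset V) = {w} := by ext y; simp [h.eq_zero_iff]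
    have e1 : ({y | lev y = 1} : Finset V) = {z} := by ext y; simp [h.eq_one_iff]
    rw [htot, Finset.sum_range_succ, Finset.sum_range_succ, Finset.sum_range_one, e0, e1,
      Finset.sum_singleton, Finset.sum_singleton, hxz,
      Finset.sum_congr rfl fun y hy => h2 y (Finset.mem_filter.1 hy).2, Finset.sum_const,
      nsmul_eq_mul] at h1
    have hcard := h.card_level_two
    have h3 : (3 : ℝ) ≤ (Finset.card {y | lev y = 2} : ℕ) := by
      exact_mod_cast (by omega : 3 ≤ Finset.card {y | lev y = 2})
    have h4 : (((Finset.card {y | lev y = 2} : ℕ) : ℝ) - 1) * x w = 0 := by linarith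
    exact (mul_eq_zero.1 h4).resolve_left (by linarith)
  funext y
  have hy := h.le_two y
  obtain hy | hy | hy : lev y = 0 ∨ lev y = 1 ∨ lev y = 2 := by omega
  · rw [(h.eq_zero_iff y).1 hy, hxw]; rfl
  · rw [(h.eq_one_iff y).1 hy, hxz]; rfl
  · rw [h2 y hy, hxw]; simp

lemma inClassG1 (h : IsThreeChain G lev w z) (hn : 5 ≤ Fintype.card V) : InClassG1 G := by
  have hne : (Fintype.card V : ℝ) - 2 ≠ 0 := by
    have : (5 : ℝ) ≤ Fintype.card V := by exact_mod_cast hn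
    linarith
  have hG := inClassG_of_rank_eq hn h.connected (h.rank_eq_three hn (inv_mul_cancel₀ hne))
  refine ⟨hG, fun hrho => ?_, h.indepNum_eq hn⟩
  obtain ⟨x, hx0, hx⟩ := exists_adj_kernel_of_rho_eq_one
    (degree_pos_of_connected h.connected hn) hrho
  exact hx0 (h.eq_zero_of_sum_neighbor_eq_zero hn hx)

end IsThreeChain

lemma isThreeChain_graphG2 {n : ℕ} (hn : 5 ≤ n) :
    IsThreeChain (graphG2 n) (fun i => min i.val 2) ⟨0, by omega⟩ ⟨1, by omega⟩ where
  adj_iff x y := by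
    change (x ≠ y ∧ _) ↔ _
    refine and_congr_right fun hxy => ?_
    rw [Ne, Fin.ext_iff] at hxy
    dsimp only
    omega
  le_two _ := min_le_right _ _
  eq_zero_iff x := by rw [Fin.ext_iff]; dsimp only; omega
  eq_one_iff x := by rw [Fin.ext_iff]; dsimp only; omega

lemma exists_isThreeChain_iff {V : Type*} [Fintype V] (G : SimpleGraph V)
    (hn : 5 ≤ Fintype.card V) :
    (∃ lev w z, IsThreeChain G lev w z) ↔ Nonempty (G ≃g graphG2 (Fintype.card V)) := by
  have h := isThreeChain_graphG2 hn
  constructor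
  · rintro ⟨lev, w, z, h'⟩
    exact h'.nonempty_iso h (Fintype.card_fin _).symm
  · rintro ⟨φ⟩
    refine ⟨_, φ.symm ⟨0, by omega⟩, φ.symm ⟨1, by omega⟩, h.adj_iff.comap φ,
      fun x => h.le_two _, fun x => ?_, fun x => ?_⟩
    · rw [φ.eq_symm_apply]
      exact h.eq_zero_iff _
    · rw [φ.eq_symm_apply]
      exact h.eq_one_iff _

/-! ### Cographs with independence number two -/

/-- The vertex set is partitioned into two cliques `P`, `Q` with no edge between them and a set `R`
all of whose vertices are adjacent to all of `P` and `Q`. -/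
structure IsTwoCliqueJoin {V : Type*} (G : SimpleGraph V) (P Q R : Finset V) : Prop where
  cover : ∀ x, x ∈ P ∨ x ∈ Q ∨ x ∈ R
  disjoint_PQ : ∀ x ∈ P, x ∉ Q
  disjoint_PR : ∀ x ∈ P, x ∉ R
  disjoint_QR : ∀ x ∈ Q, x ∉ R
  clique_P : ∀ x ∈ P, ∀ y ∈ P, x ≠ y → G.Adj x y
  clique_Q : ∀ x ∈ Q, ∀ y ∈ Q, x ≠ y → G.Adj x y
  not_adj : ∀ x ∈ P, ∀ y ∈ Q, ¬ G.Adj x y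
  adj_P : ∀ z ∈ R, ∀ x ∈ P, G.Adj z x
  adj_Q : ∀ z ∈ R, ∀ x ∈ Q, G.Adj z x

/-- In a connected cograph with independence number `2` that is not complete multipartite, there
are `w ≁ x` with a further non-neighbour of `w`. Then `P` consists of `w` and the other
non-neighbours of `x`, `Q` of `x` and the other non-neighbours of `w`, and `R` of the common
neighbours of `w` and `x`. -/
lemma exists_isTwoCliqueJoin {V : Type*} [Fintype V] {G : SimpleGraph V} (hc : G.Connected)
    (hα : G.indepNum = 2) (hG : IsCograph G) (hmp : ¬ G.IsCompleteMultipartite) :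
    ∃ P Q R : Finset V, IsTwoCliqueJoin G P Q R ∧ P.Nonempty ∧ 2 ≤ Q.card ∧ R.Nonempty := by
  classical
  obtain ⟨w, x, y, hxy, hwx, hwy⟩ := exists_isPathGraph3Compl_of_not_isCompleteMultipartite hmp
  have hne : w ≠ x := by rintro rfl; exact hwy hxy
  have hne' : w ≠ y := by rintro rfl; exact hwx hxy.symm
  have hxw : ¬ G.Adj x w := fun h => hwx h.symm
  have hcl : ∀ u a b, u ≠ a → u ≠ b → ¬ G.Adj u a → ¬ G.Adj u b → a ≠ b → G.Adj a b := by
    intro u a b h1 h2 h3 h4 h5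
    rcases adj_of_indepNum_eq_two hα h1 h2 h5 with h | h | h
    exacts [absurd h h3, absurd h h4, h]
  have hJ : IsTwoCliqueJoin G ({a | a ≠ x ∧ ¬ G.Adj x a} : Finset V)
      ({a | a ≠ w ∧ ¬ G.Adj w a} : Finset V) ({a | G.Adj w a ∧ G.Adj x a} : Finset V) := by
    constructor <;> simp only [Finset.mem_filter, Finset.mem_univ, true_and]
    · intro a
      by_cases h1 : a = w
      · exact .inl (h1 ▸ ⟨hne, hxw⟩)
      by_cases h2 : a = x
      · exact .inr (.inl (h2 ▸ ⟨hne.symm, hwx⟩))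
      tauto
    · rintro a ⟨h1, h2⟩ ⟨h3, h4⟩
      exact hwx (hcl a w x h3 h1 (fun h => h4 h.symm) (fun h => h2 h.symm) hne)
    · rintro a ⟨-, h2⟩ ⟨-, h4⟩
      exact h2 h4
    · rintro a ⟨-, h2⟩ ⟨h4, -⟩
      exact h2 h4
    · rintro a ⟨h1, h2⟩ b ⟨h3, h4⟩ hab
      exact hcl x a b h1.symm h3.symm h2 h4 hab
    · rintro a ⟨h1, h2⟩ b ⟨h3, h4⟩ hab
      exact hcl w a b h1.symm h3.symm h2 h4 hab
    · rintro a ⟨h1, h2⟩ b ⟨h3, h4⟩ hab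
      have haw : a ≠ w := by rintro rfl; exact h4 hab
      have hbx : b ≠ x := by rintro rfl; exact h2 hab.symm
      have h5 := hcl x w a hne.symm h1.symm hxw h2 haw.symm
      have h6 := hcl w b x h3.symm hne h4 hwx hbx
      rcases hG.adj_of_path h5 hab h6 hne with h | h | h
      exacts [h4 h, hwx h, h2 h.symm]
    · rintro z ⟨h1, h2⟩ a ⟨h3, h4⟩
      by_cases haw : a = w
      · exact haw ▸ h1.symm
      have h5 := hcl x w a hne.symm h3.symm hxw h4 (Ne.symm haw)
      rcases hG.adj_of_path h2 h1.symm h5 h3.symm with h | h | h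
      exacts [absurd h hxw, absurd h h4, h]
    · rintro z ⟨h1, h2⟩ a ⟨h3, h4⟩
      by_cases hax : a = x
      · exact hax ▸ h2.symm
      have h5 := hcl w x a hne h3.symm hwx h4 (Ne.symm hax)
      rcases hG.adj_of_path h1 h2.symm h5 h3.symm with h | h | h
      exacts [absurd h hwx, absurd h h4, h]
  refine ⟨_, _, _, hJ, ⟨w, by simp [hne, hxw]⟩, ?_, ?_⟩
  · exact Finset.one_lt_card.2 ⟨x, by simp [hne.symm, hwx], y, by simp [hne'.symm, hwy], hxy.ne⟩
  · obtain ⟨p⟩ := hc.preconnected w x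
    obtain ⟨d, -, hd1, hd2⟩ := p.exists_boundary_dart {a | a ≠ x ∧ ¬ G.Adj x a}
      ⟨hne, hxw⟩ (by simp)
    refine ⟨d.snd, ?_⟩
    have hd1' : d.fst ∈ ({a | a ≠ x ∧ ¬ G.Adj x a} : Finset V) := by simpa using hd1
    rcases hJ.cover d.snd with h | h | h
    · exact absurd (by simpa using h) hd2
    · exact absurd d.adj (hJ.not_adj _ hd1' _ h)
    · exact h

namespace IsTwoCliqueJoin

variable {V : Type*} [Fintype V] [DecidableEq V] {G : SimpleGraph V} {P Q R : Finset V}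

omit [Fintype V] [DecidableEq V] in
lemma symm (h : IsTwoCliqueJoin G P Q R) : IsTwoCliqueJoin G Q P R where
  cover x := by have := h.cover x; tauto
  disjoint_PQ x h1 h2 := h.disjoint_PQ x h2 h1
  disjoint_PR := h.disjoint_QR
  disjoint_QR := h.disjoint_PR
  clique_P := h.clique_Q
  clique_Q := h.clique_P
  not_adj x hx y hy h' := h.not_adj y hy x hx h'.symm
  adj_P := h.adj_Q
  adj_Q := h.adj_P

lemma card_add (h : IsTwoCliqueJoin G P Q R) : P.card + Q.card + R.card = Fintype.card V := by
  rw [← Finset.card_union_of_disjoint (Finset.disjoint_left.2 h.disjoint_PQ),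
    ← Finset.card_union_of_disjoint, ← Finset.card_univ]
  · congr 1
    ext x
    simpa [or_assoc] using h.cover x
  · rw [Finset.disjoint_left]
    intro x hx
    rcases Finset.mem_union.1 hx with h' | h'
    exacts [h.disjoint_PR x h', h.disjoint_QR x h']

variable [DecidableRel G.Adj]

lemma degree_of_mem_P (h : IsTwoCliqueJoin G P Q R) {x : V} (hx : x ∈ P) :
    (G.degree x : ℝ) = P.card + R.card - 1 := by
  have hN : G.neighborFinset x = (P ∪ R).erase x := by
    ext y
    rw [mem_neighborFinset, Finset.mem_erase, Finset.mem_union]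
    constructor
    · intro hxy
      refine ⟨hxy.ne', ?_⟩
      rcases h.cover y with h' | h' | h'
      exacts [.inl h', absurd hxy (h.not_adj x hx y h'), .inr h']
    · rintro ⟨h1, h2 | h2⟩
      exacts [h.clique_P x hx y h2 h1.symm, (h.adj_P y h2 x hx).symm]
  have hd : G.degree x + 1 = P.card + R.card := by
    rw [← card_neighborFinset_eq_degree, hN, Finset.card_erase_add_one (by simp [hx]),
      Finset.card_union_of_disjoint (Finset.disjoint_left.2 h.disjoint_PR)]
  rw [eq_sub_iff_add_eq]
  exact_mod_cast hd

lemma degree_of_mem_Q (h : IsTwoCliqueJoin G P Q R) {x : V} (hx : x ∈ Q) :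
    (G.degree x : ℝ) = Q.card + R.card - 1 := h.symm.degree_of_mem_P hx

lemma degree_le (h : IsTwoCliqueJoin G P Q R) (z : V) :
    (G.degree z : ℝ) ≤ P.card + Q.card + R.card - 1 := by
  have := G.degree_lt_card_verts z
  rw [← h.card_add] at this
  rw [le_sub_iff_add_le]
  exact_mod_cast this

lemma degree_of_clique_R (h : IsTwoCliqueJoin G P Q R) {z : V} (hz : z ∈ R)
    (hR : ∀ y ∈ R, y ≠ z → G.Adj z y) :
    (G.degree z : ℝ) = P.card + Q.card + R.card - 1 := by
  have hN : G.neighborFinset z = Finset.univ.erase z := by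
    ext y
    simp only [mem_neighborFinset, Finset.mem_erase, Finset.mem_univ, and_true]
    refine ⟨fun h' => h'.ne', fun hy => ?_⟩
    rcases h.cover y with h' | h' | h'
    exacts [h.adj_P z hz y h', h.adj_Q z hz y h', hR y h' hy]
  have hd : G.degree z + 1 = P.card + Q.card + R.card := by
    rw [← card_neighborFinset_eq_degree, hN, Finset.card_erase_add_one (by simp), h.card_add,
      Finset.card_univ]
  rw [eq_sub_iff_add_eq]
  exact_mod_cast hd

variable {c : ℝ}

omit [Fintype V] [DecidableEq V] [DecidableRel G.Adj] in
lemma ne_of_mem_P_of_mem_Q (h : IsTwoCliqueJoin G P Q R) {w x : V} (hw : w ∈ P) (hx : x ∈ Q) :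
    w ≠ x := by
  rintro rfl
  exact h.disjoint_PQ _ hw hx

lemma minor_wzxy (h : IsTwoCliqueJoin G P Q R) (hr : (adjAddDegMatrix G c).rank ≤ 3)
    {w z x y : V} (hw : w ∈ P) (hz : z ∈ R) (hx : x ∈ Q) (hy : y ∈ Q) (hxy : x ≠ y) :
    (c * (Q.card + R.card - 1) - 1) *
      (c * (P.card + R.card - 1) * (c * G.degree z) * (c * (Q.card + R.card - 1) + 1) -
        2 * (c * (P.card + R.card - 1)) - (c * (Q.card + R.card - 1) + 1)) = 0 := by
  have := minor_four_eq_zero hr w z x y w z x y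
  simp only [adjAddDegMatrix_self, h.degree_of_mem_P hw, h.degree_of_mem_Q hx,
    h.degree_of_mem_Q hy, adjAddDegMatrix_symm c x w, adjAddDegMatrix_symm c y w,
    adjAddDegMatrix_not_adj c (h.ne_of_mem_P_of_mem_Q hw hx) (h.not_adj w hw x hx),
    adjAddDegMatrix_not_adj c (h.ne_of_mem_P_of_mem_Q hw hy) (h.not_adj w hw y hy),
    adjAddDegMatrix_adj c (h.adj_P z hz w hw), adjAddDegMatrix_adj c (h.adj_P z hz w hw).symm,
    adjAddDegMatrix_adj c (h.adj_Q z hz x hx), adjAddDegMatrix_adj c (h.adj_Q z hz x hx).symm,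
    adjAddDegMatrix_adj c (h.adj_Q z hz y hy), adjAddDegMatrix_adj c (h.adj_Q z hz y hy).symm,
    adjAddDegMatrix_adj c (h.clique_Q x hx y hy hxy),
    adjAddDegMatrix_adj c (h.clique_Q x hx y hy hxy).symm] at this
  linarith

/-- The minor with rows `x y y' z` and columns `x y z w`, for three vertices of `Q`. -/
lemma weight_eq_one_of_three (h : IsTwoCliqueJoin G P Q R)
    (hr : (adjAddDegMatrix G c).rank ≤ 3) {w z : V} (hw : w ∈ P) (hz : z ∈ R)
    (hQ : 3 ≤ Q.card) : c * (Q.card + R.card - 1) = 1 := by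
  obtain ⟨x, hx, y, hy, y', hy', hxy, hxy', hyy'⟩ := Finset.two_lt_card.1 hQ
  have := minor_four_eq_zero hr x y y' z x y z w
  simp only [adjAddDegMatrix_self, h.degree_of_mem_Q hx,
    h.degree_of_mem_Q hy, adjAddDegMatrix_symm c x w, adjAddDegMatrix_symm c y w,
    adjAddDegMatrix_symm c y' w,
    adjAddDegMatrix_not_adj c (h.ne_of_mem_P_of_mem_Q hw hx) (h.not_adj w hw x hx),
    adjAddDegMatrix_not_adj c (h.ne_of_mem_P_of_mem_Q hw hy) (h.not_adj w hw y hy),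
    adjAddDegMatrix_not_adj c (h.ne_of_mem_P_of_mem_Q hw hy') (h.not_adj w hw y' hy'),
    adjAddDegMatrix_adj c (h.adj_P z hz w hw),
    adjAddDegMatrix_adj c (h.adj_Q z hz x hx), adjAddDegMatrix_adj c (h.adj_Q z hz x hx).symm,
    adjAddDegMatrix_adj c (h.adj_Q z hz y hy), adjAddDegMatrix_adj c (h.adj_Q z hz y hy).symm,
    adjAddDegMatrix_adj c (h.adj_Q z hz y' hy').symm,
    adjAddDegMatrix_adj c (h.clique_Q x hx y hy hxy),
    adjAddDegMatrix_adj c (h.clique_Q x hx y hy hxy).symm,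
    adjAddDegMatrix_adj c (h.clique_Q x hx y' hy' hxy').symm,
    adjAddDegMatrix_adj c (h.clique_Q y hy y' hy' hyy').symm] at this
  have h2 : (c * (Q.card + R.card - 1) - 1) ^ 2 = 0 := by linarith
  have := pow_eq_zero_iff (two_ne_zero) |>.1 h2
  linarith

lemma minor_wwxy (h : IsTwoCliqueJoin G P Q R) (hr : (adjAddDegMatrix G c).rank ≤ 3)
    (hP : 2 ≤ P.card) (hQ : 2 ≤ Q.card) :
    ((c * (P.card + R.card - 1)) ^ 2 - 1) * ((c * (Q.card + R.card - 1)) ^ 2 - 1) = 0 := by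
  obtain ⟨w, hw, w', hw', hww⟩ := Finset.one_lt_card.1 hP
  obtain ⟨x, hx, y, hy, hxy⟩ := Finset.one_lt_card.1 hQ
  have := minor_four_eq_zero hr w w' x y w w' x y
  simp only [adjAddDegMatrix_self, h.degree_of_mem_P hw, h.degree_of_mem_P hw',
    h.degree_of_mem_Q hx,
    h.degree_of_mem_Q hy, adjAddDegMatrix_symm c x w, adjAddDegMatrix_symm c y w,
    adjAddDegMatrix_symm c x w', adjAddDegMatrix_symm c y w',
    adjAddDegMatrix_not_adj c (h.ne_of_mem_P_of_mem_Q hw hx) (h.not_adj w hw x hx),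
    adjAddDegMatrix_not_adj c (h.ne_of_mem_P_of_mem_Q hw hy) (h.not_adj w hw y hy),
    adjAddDegMatrix_not_adj c (h.ne_of_mem_P_of_mem_Q hw' hx) (h.not_adj w' hw' x hx),
    adjAddDegMatrix_not_adj c (h.ne_of_mem_P_of_mem_Q hw' hy) (h.not_adj w' hw' y hy),
    adjAddDegMatrix_adj c (h.clique_P w hw w' hw' hww),
    adjAddDegMatrix_adj c (h.clique_P w hw w' hw' hww).symm,
    adjAddDegMatrix_adj c (h.clique_Q x hx y hy hxy),
    adjAddDegMatrix_adj c (h.clique_Q x hx y hy hxy).symm] at this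
  linarith

/-- The minor with rows `x y z z'` and columns `x y z w`. -/
lemma minor_xyzz (h : IsTwoCliqueJoin G P Q R) (hr : (adjAddDegMatrix G c).rank ≤ 3)
    {w z z' : V} (hw : w ∈ P) (hz : z ∈ R) (hz' : z' ∈ R) (hQ : 2 ≤ Q.card) :
    (c * G.degree z - adjAddDegMatrix G c z z') * ((c * (Q.card + R.card - 1)) ^ 2 - 1) = 0 := by
  obtain ⟨x, hx, y, hy, hxy⟩ := Finset.one_lt_card.1 hQ
  have := minor_four_eq_zero hr x y z z' x y z w
  simp only [adjAddDegMatrix_self, h.degree_of_mem_Q hx,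
    h.degree_of_mem_Q hy, adjAddDegMatrix_symm c x w, adjAddDegMatrix_symm c y w,
    adjAddDegMatrix_symm c z' z,
    adjAddDegMatrix_not_adj c (h.ne_of_mem_P_of_mem_Q hw hx) (h.not_adj w hw x hx),
    adjAddDegMatrix_not_adj c (h.ne_of_mem_P_of_mem_Q hw hy) (h.not_adj w hw y hy),
    adjAddDegMatrix_adj c (h.adj_P z hz w hw), adjAddDegMatrix_adj c (h.adj_P z' hz' w hw),
    adjAddDegMatrix_adj c (h.adj_Q z hz x hx), adjAddDegMatrix_adj c (h.adj_Q z hz x hx).symm,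
    adjAddDegMatrix_adj c (h.adj_Q z hz y hy), adjAddDegMatrix_adj c (h.adj_Q z hz y hy).symm,
    adjAddDegMatrix_adj c (h.adj_Q z' hz' x hx), adjAddDegMatrix_adj c (h.adj_Q z' hz' y hy),
    adjAddDegMatrix_adj c (h.clique_Q x hx y hy hxy),
    adjAddDegMatrix_adj c (h.clique_Q x hx y hy hxy).symm] at this
  linarith

lemma minor_wzzx (h : IsTwoCliqueJoin G P Q R) (hr : (adjAddDegMatrix G c).rank ≤ 3)
    {w z z' x : V} (hw : w ∈ P) (hz : z ∈ R) (hz' : z' ∈ R) (hx : x ∈ Q)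
    (hX : c * (Q.card + R.card - 1) = 1) :
    c * (P.card + R.card - 1) *
        (c * G.degree z * (c * G.degree z') - adjAddDegMatrix G c z z' ^ 2) =
      (c * (P.card + R.card - 1) + 1) *
        (c * G.degree z + c * G.degree z' - 2 * adjAddDegMatrix G c z z') := by
  have := minor_four_eq_zero hr w z z' x w z z' x
  simp only [adjAddDegMatrix_self, h.degree_of_mem_P hw, h.degree_of_mem_Q hx, hX,
    adjAddDegMatrix_symm c x w, adjAddDegMatrix_symm c z' z,
    adjAddDegMatrix_not_adj c (h.ne_of_mem_P_of_mem_Q hw hx) (h.not_adj w hw x hx),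
    adjAddDegMatrix_adj c (h.adj_P z hz w hw), adjAddDegMatrix_adj c (h.adj_P z hz w hw).symm,
    adjAddDegMatrix_adj c (h.adj_P z' hz' w hw), adjAddDegMatrix_adj c (h.adj_P z' hz' w hw).symm,
    adjAddDegMatrix_adj c (h.adj_Q z hz x hx), adjAddDegMatrix_adj c (h.adj_Q z hz x hx).symm,
    adjAddDegMatrix_adj c (h.adj_Q z' hz' x hx),
    adjAddDegMatrix_adj c (h.adj_Q z' hz' x hx).symm] at this
  linarith

/-- If `Q` has two vertices, the eigenvalue of `A + c D` on the differences of vertices of `Q`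
vanishes, since otherwise the rank would exceed `3`. -/
lemma weight_eq_one (h : IsTwoCliqueJoin G P Q R) (hn : 5 ≤ Fintype.card V)
    (hr : (adjAddDegMatrix G c).rank ≤ 3) (hP : P.Nonempty) (hR : R.Nonempty)
    (hQ : 2 ≤ Q.card) : c * (Q.card + R.card - 1) = 1 := by
  by_contra hX
  obtain ⟨w, hw⟩ := hP
  obtain ⟨z, hz⟩ := hR
  have hm1 : ∀ z ∈ R,
      c * (P.card + R.card - 1) * (c * G.degree z) * (c * (Q.card + R.card - 1) + 1) =
        2 * (c * (P.card + R.card - 1)) + (c * (Q.card + R.card - 1) + 1) := by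
    intro z hz
    obtain ⟨x, hx, y, hy, hxy⟩ := Finset.one_lt_card.1 hQ
    have := (mul_eq_zero.1 (h.minor_wzxy hr hw hz hx hy hxy)).resolve_left (sub_ne_zero.2 hX)
    linarith
  have hq : Q.card = 2 := by
    by_contra hq
    exact hX (h.weight_eq_one_of_three hr hw hz (by omega))
  have hp1 : 1 ≤ P.card := Finset.card_pos.2 ⟨w, hw⟩
  have hr1 : (1 : ℝ) ≤ R.card := by exact_mod_cast Finset.card_pos.2 ⟨z, hz⟩
  have hcard := h.card_add
  have hle := h.degree_le z
  have hc : c ≠ 0 := by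
    rintro rfl
    have := hm1 z hz
    norm_num at this
  have hw0 : c * (P.card + R.card - 1) ≠ 0 := by
    have : (1 : ℝ) ≤ P.card := by exact_mod_cast hp1
    exact mul_ne_zero hc (by linarith)
  have hXm : c * (Q.card + R.card - 1) ≠ -1 := by
    intro h'
    have := hm1 z hz
    rw [h'] at this
    exact hw0 (by linarith)
  have hX2 : (c * (Q.card + R.card - 1)) ^ 2 - 1 ≠ 0 := by
    intro h'
    rcases sq_eq_sq_iff_eq_or_eq_neg.1 ((sub_eq_zero.1 h').trans (one_pow 2).symm) with h1 | h1
    exacts [hX h1, hXm h1]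
  by_cases hp : 2 ≤ P.card
  · have hW2 := (mul_eq_zero.1 (h.minor_wwxy hr hp hQ)).resolve_right hX2
    have hW : c * (P.card + R.card - 1) = 1 := by
      by_contra hW
      have hp2 : P.card = 2 := by
        by_contra hp2
        obtain ⟨x, hx⟩ := Finset.card_pos.1 (by omega : 0 < Q.card)
        exact hW (h.symm.weight_eq_one_of_three hr hx hz (by omega))
      rw [hp2.trans hq.symm] at hW2
      exact hX2 hW2
    -- now `(Z - 1) (X + 1) = 2` for `X = c d_x < 1` and `Z = c d_z ≤ 1 + 2 c ≤ 2`
    have hm := hm1 z hz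
    have hpr : (2 : ℝ) ≤ P.card := by exact_mod_cast hp
    rw [hW] at hm
    rw [hq] at hX hm hle
    push_cast at hX hm hle
    have hc0 : 0 < c := by
      by_contra! hc0
      nlinarith
    have hX1 : c * (2 + R.card - 1) < 1 := lt_of_le_of_ne (by nlinarith) hX
    have hX0 : 0 < c * (2 + R.card - 1) := mul_pos hc0 (by linarith)
    have hZ : c * G.degree z ≤ 2 := by nlinarith
    nlinarith
  · -- `P` is a single vertex, so `|R| ≥ 2`; then `R` is a clique with `c d_z = 1` on it, and
    -- `W (X - 1) = X + 1` for `W = c d_w > 0` and `0 < X = c d_x < 1`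
    have hp1' : P.card = 1 := by omega
    have hz' : ∀ y ∈ R, c * G.degree z = adjAddDegMatrix G c z y := fun y hy => by
      have := (mul_eq_zero.1 (h.minor_xyzz hr hw hz hy hQ)).resolve_right hX2
      linarith
    have hd : c * (G.degree z : ℝ) ≠ 0 := by
      refine mul_ne_zero hc (Nat.cast_ne_zero.2 ?_)
      exact ((G.degree_pos_iff_exists_adj z).2 ⟨w, h.adj_P z hz w hw⟩).ne'
    have hadj : ∀ y ∈ R, y ≠ z → G.Adj z y := by
      intro y hy hne
      by_contra hna
      have := hz' y hy
      rw [adjAddDegMatrix_not_adj c hne.symm hna] at this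
      exact hd this
    obtain ⟨y, hy, hne⟩ := Finset.exists_mem_ne (by omega : 1 < R.card) z
    have hZ := hz' y hy
    have hm := hm1 z hz
    rw [adjAddDegMatrix_adj c (hadj y hy hne)] at hZ
    rw [hZ] at hm
    rw [h.degree_of_clique_R hz hadj] at hZ
    rw [hp1', hq] at hm hZ
    push_cast at hm hZ
    have hc0 : 0 < c := by
      by_contra! hc0
      nlinarith
    nlinarith [mul_pos hc0 hc0]

lemma card_R_eq_one (h : IsTwoCliqueJoin G P Q R) (hn : 5 ≤ Fintype.card V)
    (hr : (adjAddDegMatrix G c).rank ≤ 3) (hP : P.Nonempty) (hR : R.Nonempty)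
    (hQ : 2 ≤ Q.card) : R.card = 1 := by
  have hr1 : 0 < R.card := Finset.card_pos.2 hR
  by_contra hne
  have hX := h.weight_eq_one hn hr hP hR hQ
  obtain ⟨w, hw⟩ := hP
  obtain ⟨x, hx⟩ := Finset.card_pos.1 (by omega : 0 < Q.card)
  have hp1 : 1 ≤ P.card := Finset.card_pos.2 ⟨w, hw⟩
  have hp1r : (1 : ℝ) ≤ P.card := by exact_mod_cast hp1
  have hqr : (2 : ℝ) ≤ Q.card := by exact_mod_cast hQ
  have hrr : (2 : ℝ) ≤ R.card := by exact_mod_cast (by omega : 2 ≤ R.card)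
  have hc0 : 0 < c := by
    by_contra! hc0
    nlinarith
  have hW0 : 0 < c * (P.card + R.card - 1) := mul_pos hc0 (by linarith)
  have hd : ∀ z ∈ R, 0 < c * G.degree z := fun z hz => by
    refine mul_pos hc0 (Nat.cast_pos.2 ?_)
    exact (G.degree_pos_iff_exists_adj z).2 ⟨w, h.adj_P z hz w hw⟩
  have hbound : c * (P.card + R.card - 1) * (c * P.card) < 1 := by
    by_cases hp : 2 ≤ P.card
    · have hW := h.symm.weight_eq_one hn hr ⟨x, hx⟩ hR hp
      rw [hW]
      nlinarith
    · have hp1' : P.card = 1 := by omega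
      rw [hp1']
      push_cast
      have h1 : c * (1 + R.card - 1) < 1 := by nlinarith
      have h2 : c * 1 < 1 := by nlinarith
      nlinarith
  have hlt : ∀ z ∈ R, c * (P.card + R.card - 1) * (c * G.degree z) <
      c * (P.card + R.card - 1) + 1 := by
    intro z hz
    have h1 : c * G.degree z ≤ 1 + c * P.card := by
      have := mul_le_mul_of_nonneg_left (h.degree_le z) hc0.le
      linarith
    have h2 := mul_le_mul_of_nonneg_left h1 hW0.le
    linarith
  -- with `W = c d_w` and `Z = c d_z`, the minor on `w z y x` gives `W Z = W + 2` if `R` is a clique,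
  -- and `W Z > W + 1` at a nonadjacent pair in `R`
  by_cases hcl : ∀ z ∈ R, ∀ y ∈ R, y ≠ z → G.Adj z y
  · obtain ⟨z, hz, y, hy, hzy⟩ := Finset.one_lt_card.1 (by omega : 1 < R.card)
    have hm := h.minor_wzzx hr hw hz hy hx hX
    have hl := hlt z hz
    rw [adjAddDegMatrix_adj c (hcl z hz y hy hzy.symm), h.degree_of_clique_R hy (hcl y hy),
      h.degree_of_clique_R hz (hcl z hz)] at hm
    rw [h.degree_of_clique_R hz (hcl z hz)] at hl
    have hZ : 0 < c * (P.card + Q.card + R.card - 1) - 1 := by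
      have : 0 < c * P.card := mul_pos hc0 (by linarith)
      linarith
    have h3 : (c * (P.card + Q.card + R.card - 1) - 1) * (c * (P.card + R.card - 1) *
        (c * (P.card + Q.card + R.card - 1)) - (c * (P.card + R.card - 1) + 2)) = 0 := by
      linarith
    have := (mul_eq_zero.1 h3).resolve_left hZ.ne'
    linarith
  · push Not at hcl
    obtain ⟨z, hz, y, hy, hne', hna⟩ := hcl
    have hm := h.minor_wzzx hr hw hz hy hx hX
    rw [adjAddDegMatrix_not_adj c hne'.symm hna] at hm
    have h1 := mul_lt_mul_of_pos_right (hlt z hz) (hd y hy)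
    have h2 := mul_pos (add_pos hW0 one_pos) (hd z hz)
    linarith

/-- If both cliques have two vertices and `R = {z}`, then all rows of `A + c D` are combinations of
a row from `P` and a row from `Q`. -/
lemma card_P_eq_one (h : IsTwoCliqueJoin G P Q R) (hn : 5 ≤ Fintype.card V)
    (hr : (adjAddDegMatrix G c).rank = 3) (hP : P.Nonempty) (hR : R.Nonempty)
    (hQ : 2 ≤ Q.card) : P.card = 1 := by
  have hR1 := h.card_R_eq_one hn hr.le hP hR hQ
  have hX := h.weight_eq_one hn hr.le hP hR hQ
  have hp0 : 0 < P.card := Finset.card_pos.2 hP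
  by_contra hne
  obtain ⟨w, hw⟩ := hP
  obtain ⟨x, hx⟩ := Finset.card_pos.1 (by omega : 0 < Q.card)
  have hW := h.symm.weight_eq_one hn hr.le ⟨x, hx⟩ hR (by omega)
  obtain ⟨z, rfl⟩ := Finset.card_eq_one.1 hR1
  have hzR : z ∈ ({z} : Finset V) := Finset.mem_singleton_self z
  have hZ : c * G.degree z = 2 := by
    rw [h.degree_of_clique_R hzR fun y hy hne => absurd (Finset.mem_singleton.1 hy) hne]
    rw [hR1] at hX hW ⊢
    push_cast at *
    linarith
  have ePP : ∀ a ∈ P, ∀ b ∈ P, adjAddDegMatrix G c a b = 1 := by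
    intro a ha b hb
    by_cases hab : a = b
    · rw [hab, adjAddDegMatrix_self, h.degree_of_mem_P hb, hW]
    · exact adjAddDegMatrix_adj c (h.clique_P a ha b hb hab)
  have eQQ : ∀ a ∈ Q, ∀ b ∈ Q, adjAddDegMatrix G c a b = 1 := by
    intro a ha b hb
    by_cases hab : a = b
    · rw [hab, adjAddDegMatrix_self, h.degree_of_mem_Q hb, hX]
    · exact adjAddDegMatrix_adj c (h.clique_Q a ha b hb hab)
  have ePQ : ∀ a ∈ P, ∀ b ∈ Q, adjAddDegMatrix G c a b = 0 := fun a ha b hb =>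
    adjAddDegMatrix_not_adj c (h.ne_of_mem_P_of_mem_Q ha hb) (h.not_adj a ha b hb)
  have eQP : ∀ a ∈ Q, ∀ b ∈ P, adjAddDegMatrix G c a b = 0 := fun a ha b hb => by
    rw [adjAddDegMatrix_symm, ePQ b hb a ha]
  have eZP : ∀ a ∈ P, adjAddDegMatrix G c z a = 1 := fun a ha =>
    adjAddDegMatrix_adj c (h.adj_P z hzR a ha)
  have eZQ : ∀ a ∈ Q, adjAddDegMatrix G c z a = 1 := fun a ha =>
    adjAddDegMatrix_adj c (h.adj_Q z hzR a ha)
  have ePZ : ∀ a ∈ P, adjAddDegMatrix G c a z = 1 := fun a ha => by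
    rw [adjAddDegMatrix_symm, eZP a ha]
  have eQZ : ∀ a ∈ Q, adjAddDegMatrix G c a z = 1 := fun a ha => by
    rw [adjAddDegMatrix_symm, eZQ a ha]
  have : (adjAddDegMatrix G c).rank ≤ 2 := by
    refine rank_le_of_rows_eq_sum ![w, x] fun a => ?_
    rcases h.cover a with ha | ha | ha
    · refine ⟨![1, 0], fun b => ?_⟩
      simp only [Fin.sum_univ_two, Matrix.cons_val, one_mul, zero_mul, add_zero]
      rcases h.cover b with hb | hb | hb
      · rw [ePP a ha b hb, ePP w hw b hb]
      · rw [ePQ a ha b hb, ePQ w hw b hb]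
      · rw [Finset.mem_singleton.1 hb, ePZ a ha, ePZ w hw]
    · refine ⟨![0, 1], fun b => ?_⟩
      simp only [Fin.sum_univ_two, Matrix.cons_val, one_mul, zero_mul, zero_add]
      rcases h.cover b with hb | hb | hb
      · rw [eQP a ha b hb, eQP x hx b hb]
      · rw [eQQ a ha b hb, eQQ x hx b hb]
      · rw [Finset.mem_singleton.1 hb, eQZ a ha, eQZ x hx]
    · refine ⟨![1, 1], fun b => ?_⟩
      simp only [Fin.sum_univ_two, Matrix.cons_val, one_mul]
      rw [Finset.mem_singleton.1 ha]
      rcases h.cover b with hb | hb | hb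
      · rw [eZP b hb, ePP w hw b hb, eQP x hx b hb, add_zero]
      · rw [eZQ b hb, ePQ w hw b hb, eQQ x hx b hb, zero_add]
      · rw [Finset.mem_singleton.1 hb, adjAddDegMatrix_self, hZ, ePZ w hw, eQZ x hx]
        norm_num
  omega

lemma exists_isThreeChain (h : IsTwoCliqueJoin G P Q R) (hn : 5 ≤ Fintype.card V)
    (hr : (adjAddDegMatrix G c).rank = 3) (hP : P.Nonempty) (hR : R.Nonempty)
    (hQ : 2 ≤ Q.card) : ∃ lev w z, IsThreeChain G lev w z := by
  obtain ⟨w, rfl⟩ := Finset.card_eq_one.1 (h.card_P_eq_one hn hr hP hR hQ)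
  obtain ⟨z, rfl⟩ := Finset.card_eq_one.1 (h.card_R_eq_one hn hr.le hP hR hQ)
  have hw := Finset.mem_singleton_self w
  have hz := Finset.mem_singleton_self z
  have hzw := h.adj_P z hz w hw
  have key : ∀ x, x = w ∨ x = z ∨ (x ≠ w ∧ x ≠ z ∧ x ∈ Q) := by
    intro x
    by_cases h1 : x = w
    · exact .inl h1
    by_cases h2 : x = z
    · exact .inr (.inl h2)
    have := h.cover x
    simp only [Finset.mem_singleton, h1, h2, false_or, or_false] at this
    exact .inr (.inr ⟨h1, h2, this⟩)
  refine ⟨fun x => if x = w then 0 else if x = z then 1 else 2, w, z, ?_, ?_, ?_, ?_⟩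
  · intro x y
    have hne := hzw.ne
    rcases key x with rfl | rfl | ⟨a1, a2, a3⟩ <;> rcases key y with rfl | rfl | ⟨b1, b2, b3⟩
    · simp
    · simp [hne, hne.symm, hzw.symm]
    · simp [b1, b2, h.not_adj x hw y b3]
    · simp [hne, hzw]
    · simp
    · simp [hne, b1, b2, b2.symm, h.adj_Q x hz y b3]
    · simp [a1, a2, G.adj_comm x, h.not_adj y hw x a3]
    · simp [hne, a1, a2, (h.adj_Q y hz x a3).symm]
    · simp only [a1, a2, b1, b2, if_false]
      simpa using ⟨fun h' => h'.ne, h.clique_Q x a3 y b3⟩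
  · intro x
    split_ifs <;> omega
  · intro x
    split_ifs <;> simp_all
  · intro x
    have := hzw.ne'
    split_ifs <;> simp_all

end IsTwoCliqueJoin

/-! ### The characterization -/

theorem theorem1p1 {V : Type*} [Fintype V] [DecidableEq V] (G : SimpleGraph V)
    [DecidableRel G.Adj] (hn : 5 ≤ Fintype.card V) :
    ((InClassG1 G ∧ G.diam = 3) ↔
      ∃ a b : ℕ, a + b + 4 = Fintype.card V ∧ Nonempty (G ≃g graphG1 a b)) ∧
    ((InClassG1 G ∧ IsCograph G) ↔ Nonempty (G ≃g graphG2 (Fintype.card V))) := by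
  constructor
  · rw [← exists_isFourChain_iff]
    constructor
    · rintro ⟨hG, hd⟩
      obtain ⟨c, hc⟩ := hG.toInClassG.exists_rank_eq
      obtain ⟨u, p, q, v, h, hp, hq, hpq⟩ := exists_isClosedNeighborPartition hG.indepNum_eq hd
      obtain ⟨lev, hlev⟩ := h.exists_isFourChain hc.le hp hq hpq
      exact ⟨lev, u, p, q, v, hlev⟩
    · rintro ⟨lev, u, p, q, v, h⟩
      exact ⟨h.inClassG1 hn, h.diam_eq_three⟩
  · rw [← exists_isThreeChain_iff G hn]
    constructor
    · rintro ⟨hG, hcog⟩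
      obtain ⟨c, hc⟩ := hG.toInClassG.exists_rank_eq
      have hmp : ¬ G.IsCompleteMultipartite := by
        intro hmp
        obtain ⟨a, b, hab, hnab⟩ := exists_not_adj_of_indepNum_eq_two hG.indepNum_eq
        exact hG.rho_ne_one (rho_eq_one_of_isCompleteMultipartite
          (degree_pos_of_connected hG.connected hn) hmp hab hnab _)
      obtain ⟨P, Q, R, h, hP, hQ, hR⟩ :=
        exists_isTwoCliqueJoin hG.connected hG.indepNum_eq hcog hmp
      exact h.exists_isThreeChain hn hc hP hR hQ
    · rintro ⟨lev, w, z, h⟩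
      exact ⟨h.inClassG1 hn, h.isCograph⟩
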